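/- A discrete optimization problem $\mathcal P$ is a family of instances; each instance $I$, encoded by a bit string, determines a finite set $E=\{e_1,\dots,e_n\}$ of elements and a set $\Phi\subseteq 2^E$ of feasible solutions. A scenario is a vector $\mathbf c=(c_1,\dots,c_n)$ of nonnegative element costs, and $F(X,\mathbf c)=\sum_{e_i\in X}c_i$ is the cost of $X\in\Phi$ under $\mathbf c$. Fix a number $K\ge 1$ of scenarios. **Exact problem associated with $\mathcal P$.** Given an instance $I$ of $\mathcal P$, scenarios $\mathbf c_1,\dots,\mathbf c_K$ with nonnegative integer costs and nonnegative integers $b_1,\dots,b_K$, decide whether there is $X\in\Phi$ with $F(X,\mathbf c_j)=b_j$ for all $j\in\{1,\dots,K\}$. It is solvable in pseudopolynomial time if some algorithm decides it in time bounded by a polynomial in the input size and in the largest of the numbers $c_{ji}$, $b_j$ (so the time is polynomial in the length of the encoding of $I$). **Min-WOWA $\mathcal P$.** Given an instance $I$ of $\mathcal P$, scenarios $\mathbf c_1,\dots,\mathbf c_K$ with nonnegative rational costs, and rational vectors $\mathbf v,\mathbf p\in[0,1]^K$ with $\sum_j v_j=\sum_j p_j=1$, minimize over $X\in\Phi$ $$\mathrm{WOWA}(X)=\mathrm{wowa}_{(\mathbf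 v,\mathbf p)}(F(X,\mathbf c_1),\dots,F(X,\mathbf c_K)).$$ Here $\mathrm{wowa}_{(\mathbf v,\mathbf p)}(\mathbf a)=\sum_{j=1}^K\omega_j a_{\sigma(j)}$, where $\sigma$ is a permutation of $\{1,\dots,K\}$ with $a_{\sigma(1)}\ge\dots\ge a_{\sigma(K)}$, $\omega_j=w^*\big(\sum_{i\le j}p_{\sigma(i)}\big)-w^*\big(\sum_{i<j}p_{\sigma(i)}\big)$, and $w^*:[0,1]\to[0,1]$ is the continuous function that is linear on each interval $[\frac{j-1}{K},\frac jK]$ and satisfies $w^*(0)=0$ and $w^*(\frac jK)=\sum_{i\le j}v_i$ for $j=1,\dots,K$. **Theorem.** If the exact problem associated with $\mathcal P$ (with $K$ scenarios) can be solved in pseudopolynomial time, then Min-WOWA $\mathcal P$ (with $K$ scenarios) admits an FPTAS: there is an algorithm which, given an instance of Min-WOWA $\mathcal P$ and a rational $\epsilon>0$, returns in time polynomial in the input size and $1/\epsilon$ a solution $X\in\Phi$ with $\mathrm{WOWA}(X)\le(1+\epsilon)\,\mathrm{WOWA}(Y)$ for all $Y\in\Phi$, or reports that $\Phi=\emptyset$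 if this is the case. -/

import Mathlib

namespace MinWowa

/-! ### A model of computation with a bit-cost step count -/

/-- Values handled by programs: binary trees whose leaves are natural numbers. -/
inductive Data : Type
  | nat (n : ℕ) : Data
  | pair (a b : Data) : Data

namespace Data

/-- Size of a value: the natural numbers at the leaves are measured in binary. -/
def size : Data → ℕ
  | nat n => Nat.size n + 1
  | pair a b => a.size + b.size + 1

/-- A list is encoded as a chain of pairs that ends in `nat 0`. -/
def ofList (l : List Data) : Data := l.foldr pair (nat 0)

/-- A truth value as a number. -/
def ofBool (b : Bool) : Data := nat (if b then 1 else 0)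

/-- A bit string. -/
def ofBits (l : List Bool) : Data := ofList (l.map ofBool)

/-- A nonnegative rational number: numerator and denominator in lowest terms. -/
def ofRat (q : ℚ) : Data := pair (nat q.num.natAbs) (nat q.den)

/-- A vector. -/
def ofVec {α : Type} (e : α → Data) {n : ℕ} (x : Fin n → α) : Data :=
  ofList (List.ofFn fun i => e (x i))

open Classical in
/-- A subset of `Fin n`, as its 0-1 characteristic vector. -/
noncomputable def ofSubset {n : ℕ} (X : Finset (Fin n)) : Data :=
  ofVec (fun i => ofBool (decide (i ∈ X))) id

/-- An optional value. -/
def ofOption {α : Type} (e : α → Data) : Option α → Data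
  | none => nat 0
  | some a => pair (nat 1) (e a)

/-- Apply a binary operation on natural numbers to a pair of numbers
(the result is `0` on values of any other shape). -/
def binop (f : ℕ → ℕ → ℕ) : Data → Data
  | pair (nat a) (nat b) => nat (f a b)
  | _ => nat 0

end Data

/-- Primitive operations. Subtraction is truncated and division is rounded down. -/
inductive Prim : Type
  | id
  | const (n : ℕ)
  | fst
  | snd
  | add
  | sub
  | mul
  | div

/-- The function that a primitive operation computes. -/
def Prim.apply : Prim → Data → Data
  | .id, x => x
  | .const n, _ => .nat n
  | .fst, .pair a _ => a
  | .fst, .nat _ => .nat 0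
  | .snd, .pair _ b => b
  | .snd, .nat _ => .nat 0
  | .add, x => x.binop (· + ·)
  | .sub, x => x.binop (· - ·)
  | .mul, x => x.binop (· * ·)
  | .div, x => x.binop (· / ·)

/-- Programs. A program transforms one value into another:
`seq c d` runs `c` and then `d` on its result;
`pair c d` runs `c` and `d` on the same input and pairs the results;
`cond b c d` runs `c` if the test `b` gives anything but `nat 0`, and `d` otherwise;
`loop b c` repeats `c` as long as the test `b` gives anything but `nat 0`. -/
inductive Code : Type
  | prim (o : Prim)
  | seq (c d : Code)
  | pair (c d : Code)
  | cond (b c d : Code)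
  | loop (b c : Code)

/-- `c.Runs x y t`: on input `x` the program `c` halts with output `y` after time `t`.
Every step is charged the full size of the values that it reads, copies or writes, so that time
is polynomially related to the time of a Turing machine. -/
inductive Code.Runs : Code → Data → Data → ℕ → Prop
  | prim (o : Prim) (x : Data) :
      Runs (.prim o) x (o.apply x) (1 + x.size + (o.apply x).size)
  | seq {c d : Code} {x y z : Data} {s t : ℕ} :
      Runs c x y s → Runs d y z t → Runs (.seq c d) x z (1 + x.size + s + t)
  | pair {c d : Code} {x y z : Data} {s t : ℕ} :
      Runs c x y s → Runs d x z t → Runs (.pair c d) x (.pair y z) (1 + x.size + s + t)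
  | cond_true {b c d : Code} {x r y : Data} {s t : ℕ} :
      Runs b x r s → r ≠ .nat 0 → Runs c x y t → Runs (.cond b c d) x y (1 + x.size + s + t)
  | cond_false {b c d : Code} {x y : Data} {s t : ℕ} :
      Runs b x (.nat 0) s → Runs d x y t → Runs (.cond b c d) x y (1 + x.size + s + t)
  | loop_stop {b c : Code} {x : Data} {s : ℕ} :
      Runs b x (.nat 0) s → Runs (.loop b c) x x (1 + x.size + s)
  | loop_step {b c : Code} {x r y z : Data} {s t u : ℕ} :
      Runs b x r s → r ≠ .nat 0 → Runs c x y t → Runs (.loop b c) y z u →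
      Runs (.loop b c) x z (1 + x.size + s + t + u)

/-- Programs are deterministic. -/
theorem Code.Runs.det {c : Code} {x y y' : Data} {t t' : ℕ}
    (h : c.Runs x y t) (h' : c.Runs x y' t') : y = y' ∧ t = t' := by
  induction h generalizing y' t' with
  | prim o x => cases h'; exact ⟨rfl, rfl⟩
  | seq _ _ ih1 ih2 =>
    cases h' with
    | seq h1 h2 =>
      obtain ⟨rfl, rfl⟩ := ih1 h1
      obtain ⟨rfl, rfl⟩ := ih2 h2
      exact ⟨rfl, rfl⟩
  | pair _ _ ih1 ih2 =>
    cases h' with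
    | pair h1 h2 =>
      obtain ⟨rfl, rfl⟩ := ih1 h1
      obtain ⟨rfl, rfl⟩ := ih2 h2
      exact ⟨rfl, rfl⟩
  | cond_true _ hr _ ih1 ih2 =>
    cases h' with
    | cond_true h1 _ h2 =>
      obtain ⟨rfl, rfl⟩ := ih1 h1
      obtain ⟨rfl, rfl⟩ := ih2 h2
      exact ⟨rfl, rfl⟩
    | cond_false h1 h2 => exact absurd (ih1 h1).1 hr
  | cond_false _ _ ih1 ih2 =>
    cases h' with
    | cond_true h1 hr h2 => exact absurd (ih1 h1).1.symm hr
    | cond_false h1 h2 =>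
      obtain ⟨_, rfl⟩ := ih1 h1
      obtain ⟨rfl, rfl⟩ := ih2 h2
      exact ⟨rfl, rfl⟩
  | loop_stop _ ih =>
    cases h' with
    | loop_stop h1 =>
      obtain ⟨_, rfl⟩ := ih h1
      exact ⟨rfl, rfl⟩
    | loop_step h1 hr _ _ => exact absurd (ih h1).1.symm hr
  | loop_step _ hr _ _ ih1 ih2 ih3 =>
    cases h' with
    | loop_stop h1 => exact absurd (ih1 h1).1 hr
    | loop_step h1 _ h2 h3 =>
      obtain ⟨rfl, rfl⟩ := ih1 h1
      obtain ⟨rfl, rfl⟩ := ih2 h2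
      obtain ⟨rfl, rfl⟩ := ih3 h3
      exact ⟨rfl, rfl⟩

/-- Everything that a program writes is paid for: the time bounds the size of the output. -/
theorem Code.Runs.size_le {c : Code} {x y : Data} {t : ℕ} (h : c.Runs x y t) : y.size ≤ t := by
  induction h <;> (try simp only [Data.size]) <;> omega

/-! ### Pseudopolynomial time and approximation schemes -/

/-- A decision problem whose instances have an encoding (its size is the input size) and a
designated largest number. -/
structure DecisionProblem where
  Inst : Type
  encode : Inst → Data
  maxNumber : Inst → ℕ
  Holds : Inst → Prop

open Classical in
/-- Some program decides the problem, in time polynomial in the input size and in the value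
(not only the length) of the largest number. -/
def DecisionProblem.SolvableInPseudopolynomialTime (D : DecisionProblem) : Prop :=
  ∃ (c : Code) (q : Polynomial ℕ), ∀ J : D.Inst,
    ∃ t ≤ q.eval ((D.encode J).size + D.maxNumber J),
      c.Runs (D.encode J) (Data.ofBool (decide (D.Holds J))) t

/-- A minimization problem over the feasible solutions of an instance. -/
structure MinProblem where
  Inst : Type
  encode : Inst → Data
  Sol : Inst → Type
  encodeSol : (J : Inst) → Sol J → Data
  feasible : (J : Inst) → Set (Sol J)
  value : (J : Inst) → Sol J → ℚ

/-- `out` is a correct answer for the approximation factor `1 + ε`: a feasible solution whose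
value is at most `1 + ε` times the value of every feasible solution, or `none` if the instance
has no feasible solution. -/
def MinProblem.IsApproximateAnswer (M : MinProblem) (J : M.Inst) (ε : ℚ) :
    Option (M.Sol J) → Prop
  | none => M.feasible J = ∅
  | some X => X ∈ M.feasible J ∧ ∀ Y ∈ M.feasible J, M.value J X ≤ (1 + ε) * M.value J Y

/-- The input of an approximation scheme: an instance and a rational accuracy. -/
def MinProblem.schemeInput (M : MinProblem) (J : M.Inst) (ε : ℚ) : Data :=
  .pair (M.encode J) (Data.ofRat ε)

/-- A fully polynomial-time approximation scheme: one program that, given an instance and a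
rational `ε > 0`, finds a `(1 + ε)`-approximate solution in time polynomial in the input size
and `1 / ε`. -/
def MinProblem.AdmitsFPTAS (M : MinProblem) : Prop :=
  ∃ (c : Code) (q : Polynomial ℕ), ∀ (J : M.Inst) (ε : ℚ), 0 < ε →
    ∃ out : Option (M.Sol J), M.IsApproximateAnswer J ε out ∧
      ∃ t ≤ q.eval ((M.schemeInput J ε).size + ⌈1 / ε⌉₊),
        c.Runs (M.schemeInput J ε) (Data.ofOption (M.encodeSol J) out) t

/-! ### The WOWA operator -/

/-- The piecewise linear function `w*` on `[0, 1]` induced by the weights `v`. The `j`-th summand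
(`j = 0, …, K - 1`) vanishes up to `j / K`, rises linearly on `[j / K, (j + 1) / K]`, and equals
`v j` from there on. -/
def wStar {F : Type*} [Field F] [LinearOrder F] {K : ℕ} (v : Fin K → F) (x : F) : F :=
  ∑ j : Fin K, v j * max 0 (min 1 ((K : F) * x - (j : ℕ)))

/-- A permutation that puts the entries of `a` in nonincreasing order. -/
def sortDesc {F : Type*} [LinearOrder F] {K : ℕ} (a : Fin K → F) : Equiv.Perm (Fin K) :=
  Tuple.sort fun j => OrderDual.toDual (a j)

/-- The weighted ordered weighted averaging operator. -/
def wowa {F : Type*} [Field F] [LinearOrder F] {K : ℕ} (v p a : Fin K → F) : F :=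
  ∑ j : Fin K,
    (wStar v (∑ i ∈ Finset.Iic j, p (sortDesc a i)) -
      wStar v (∑ i ∈ Finset.Iio j, p (sortDesc a i))) * a (sortDesc a j)

theorem sortDesc_antitone {F : Type*} [LinearOrder F] {K : ℕ} (a : Fin K → F) :
    Antitone fun j => a (sortDesc a j) :=
  fun _ _ h => OrderDual.toDual_le_toDual.1
    (Tuple.monotone_sort (fun j => OrderDual.toDual (a j)) h)

/-- At the node `m / K` the function `w*` is the sum of the first `m` weights. -/
theorem wStar_node {F : Type*} [Field F] [LinearOrder F] [IsStrictOrderedRing F] {K : ℕ} (hK : 0 < K) (v : Fin K → F) (m : ℕ) :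
    wStar v ((m : F) / K) = ∑ j ∈ Finset.univ.filter (fun j : Fin K => (j : ℕ) < m), v j := by
  have hK' : (K : F) ≠ 0 := by exact_mod_cast hK.ne'
  rw [wStar, Finset.sum_filter]
  refine Finset.sum_congr rfl fun j _ => ?_
  rw [mul_div_cancel₀ _ hK']
  split_ifs with h
  · have : ((j : ℕ) : F) + 1 ≤ m := by exact_mod_cast h
    rw [min_eq_left (by linarith), max_eq_right zero_le_one, mul_one]
  · have : (m : F) ≤ (j : ℕ) := by exact_mod_cast not_lt.1 h
    rw [max_eq_left ((min_le_right _ _).trans (by linarith)), mul_zero]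

/-- Between two neighbouring nodes the function `w*` is linear. -/
theorem wStar_between {F : Type*} [Field F] [LinearOrder F] [IsStrictOrderedRing F] {K : ℕ} (v : Fin K → F) (m : Fin K) {s : F}
    (h0 : 0 ≤ s) (h1 : s ≤ 1) :
    wStar v (((m : ℕ) + s) / K) = wStar v (((m : ℕ) : F) / K) + s * v m := by
  have hK : 0 < K := m.pos
  have hK' : (K : F) ≠ 0 := by exact_mod_cast hK.ne'
  have hs : s * v m = ∑ j : Fin K, if j = m then s * v j else 0 := by simp
  rw [hs, wStar, wStar, ← Finset.sum_add_distrib]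
  refine Finset.sum_congr rfl fun j _ => ?_
  rw [mul_div_cancel₀ _ hK', mul_div_cancel₀ _ hK']
  rcases lt_trichotomy j m with h | rfl | h
  · have : ((j : ℕ) : F) + 1 ≤ (m : ℕ) := by exact_mod_cast h
    rw [min_eq_left (by linarith), min_eq_left (by linarith), if_neg h.ne, add_zero]
  · rw [if_pos rfl, add_sub_cancel_left, sub_self, min_eq_right h1, max_eq_right h0,
      min_eq_right zero_le_one, max_self]
    ring
  · have : ((m : ℕ) : F) + 1 ≤ (j : ℕ) := by exact_mod_cast h
    rw [max_eq_left ((min_le_right _ _).trans (by linarith)),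
      max_eq_left ((min_le_right _ _).trans (by linarith)), if_neg h.ne', mul_zero, add_zero]

/-! ### Discrete optimization problems and their versions with several cost scenarios -/

/-- A discrete optimization problem `𝒫`, without the costs: every instance description, encoded
by a bit string, determines a finite set `E = Fin n` of elements and a set `Φ ⊆ 2 ^ E` of
feasible solutions. -/
structure DiscreteProblem where
  Inst : Type
  encoding : Computability.Encoding Inst Bool
  numElements : Inst → ℕ
  feasible : (I : Inst) → Set (Finset (Fin (numElements I)))

/-- The cost `F(X, c)` of a solution `X` under the scenario `c`. -/
def solutionCost {R : Type*} [AddCommMonoid R] {n : ℕ} (X : Finset (Fin n)) (c : Fin n → R) : R :=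
  ∑ i ∈ X, c i

/-- An instance of the exact problem: integer costs under `K` scenarios and a target vector. -/
structure ExactInstance (P : DiscreteProblem) (K : ℕ) where
  inst : P.Inst
  cost : Fin K → Fin (P.numElements inst) → ℕ
  target : Fin K → ℕ

/-- The exact problem: is there a feasible solution whose cost under each scenario equals the
prescribed one? The largest number is taken over the costs and the targets. -/
def exactProblem (P : DiscreteProblem) (K : ℕ) : DecisionProblem where
  Inst := ExactInstance P K
  encode J := .pair (Data.ofBits (P.encoding.encode J.inst))
    (.pair (Data.ofVec (Data.ofVec Data.nat) J.cost) (Data.ofVec Data.nat J.target))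
  maxNumber J := max (Finset.univ.sup fun j => Finset.univ.sup (J.cost j))
    (Finset.univ.sup J.target)
  Holds J := ∃ X ∈ P.feasible J.inst, ∀ j, solutionCost X (J.cost j) = J.target j

/-- An instance of Min-WOWA `𝒫`: nonnegative rational costs under `K` scenarios, the weights `v`
and the scenario probabilities `p`. -/
structure WowaInstance (P : DiscreteProblem) (K : ℕ) where
  inst : P.Inst
  cost : Fin K → Fin (P.numElements inst) → ℚ
  v : Fin K → ℚ
  p : Fin K → ℚ
  cost_nonneg : ∀ j i, 0 ≤ cost j i
  v_nonneg : ∀ j, 0 ≤ v j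
  v_sum : ∑ j, v j = 1
  p_nonneg : ∀ j, 0 ≤ p j
  p_sum : ∑ j, p j = 1

/-- The problem Min-WOWA `𝒫` with `K` scenarios. -/
noncomputable def minWowa (P : DiscreteProblem) (K : ℕ) : MinProblem where
  Inst := WowaInstance P K
  encode J := .pair (Data.ofBits (P.encoding.encode J.inst))
    (.pair (Data.ofVec (Data.ofVec Data.ofRat) J.cost)
      (.pair (Data.ofVec Data.ofRat J.v) (Data.ofVec Data.ofRat J.p)))
  Sol J := Finset (Fin (P.numElements J.inst))
  encodeSol _ X := Data.ofSubset X
  feasible J := P.feasible J.inst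
  value J X := wowa J.v J.p fun j => solutionCost X (J.cost j)

end MinWowa

namespace MinWowa

/-! ### Polynomial-time functions between encoded types -/

/-! Approximation. Scale all rational data to integers. Fix a feasible `Y` and, in each scenario,
let `b` be the largest cost of a single element of `Y`. Replace a cost `c ≤ b` by `⌊c r / b⌋` with
`r = n m` and `m ≥ 1 / ε`, and a cost `c > b` by `n r + 1`, which exceeds the whole rounded cost of
`Y`. A feasible `X` with the same rounded totals as `Y` then avoids all elements with `c > b`.
Rounding loses at most `b / r` per element, hence at most `n b / r = b / m ≤ c(Y) / m` altogether,
so `c(X) ≤ (1 + 1 / m) c(Y) ≤ (1 + ε) c(Y)` in every scenario (`cost_le_of_rounded_eq`). WOWA is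
monotone and positively homogeneous (`wowa_mono`, `wowa_smul`), so its value also grows by a factor
of at most `1 + ε`. Monotonicity follows from the layer-cake formula `wowa_natCast`, a sum of values
of the monotone function `w*` at probabilities of superlevel sets.

Search. The set `Y` is unknown, but `b` is `0` or one of `n` costs and the rounded total is at most
`n r`, so all `((n + 1) (n r + 1)) ^ K` guesses can be tried. The exact problem decides whether a
guess is realized; its numbers are polynomial in value, so a pseudopolynomial algorithm is
polynomial here. To construct a solution, the rounded costs are multiplied by `n + 1`, and a
low-order digit counts the elements of a prescribed set `S`; the query then asks for a solution
containing `S` (`ask_iff`), and `S` is grown element by element (`greedy_spec`). The best candidate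
is selected by comparing exact integer multiples of WOWA (`cast_val`).

Running time. `PolyTime` is closed under composition, case distinction and bounded iteration. Its
measure `mu` is the size plus the largest number on exact instances and the size plus `⌈1 / ε⌉` on
scheme inputs, so the same notion expresses the hypothesis and the conclusion. -/

/-- An encoding of a type as data, with a measure of the elements that bounds the encoding size. -/
class Enc (α : Type) where
  enc : α → Data
  mu : α → ℕ
  size_enc_le : ∀ a, (enc a).size ≤ mu a

open Enc

theorem Data.size_pos (x : Data) : 0 < x.size := by
  cases x <;> simp [Data.size]

instance : Enc ℕ := ⟨Data.nat, fun n => Nat.size n + 1, fun _ => le_rfl⟩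

/-- The measure is constant so that the measure of a bit list depends on its length only. -/
instance : Enc Bool := ⟨Data.ofBool, fun _ => 2, fun b => by cases b <;> simp [Data.ofBool, Data.size]⟩

instance {α β : Type} [Enc α] [Enc β] : Enc (α × β) :=
  ⟨fun x => .pair (enc x.1) (enc x.2), fun x => mu x.1 + mu x.2 + 1, fun x => by
    simp only [Data.size]; have := size_enc_le x.1; have := size_enc_le x.2; omega⟩

/-- The measure of a list. -/
def muList {α : Type} [Enc α] : List α → ℕ
  | [] => 1
  | a :: l => mu a + muList l + 1

instance {α : Type} [Enc α] : Enc (List α) :=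
  ⟨fun l => Data.ofList (l.map enc), muList, fun l => by
    induction l with
    | nil => simp [Data.ofList, muList, Data.size]
    | cons a l ih =>
      simp only [Data.ofList, List.map_cons, List.foldr_cons, muList, Data.size] at ih ⊢
      have := size_enc_le a
      omega⟩

instance {α : Type} [Enc α] : Enc (Option α) :=
  ⟨Data.ofOption enc, fun o => o.elim 1 fun a => mu a + 3, fun o => by
    cases o with
    | none => simp [Data.ofOption, Data.size]
    | some a =>
      have := size_enc_le a
      simp [Data.ofOption, Data.size]; omega⟩

section EncLemmas
variable {α β : Type} [Enc α] [Enc β]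

theorem mu_pos (a : α) : 0 < mu a := (Data.size_pos _).trans_le (size_enc_le a)

@[simp] theorem enc_nat (n : ℕ) : enc n = Data.nat n := rfl
@[simp] theorem enc_prod (x : α × β) : enc x = .pair (enc x.1) (enc x.2) := rfl
@[simp] theorem enc_nil : enc ([] : List α) = Data.nat 0 := rfl
@[simp] theorem enc_cons (a : α) (l : List α) : enc (a :: l) = .pair (enc a) (enc l) := rfl
@[simp] theorem enc_none : enc (none : Option α) = Data.nat 0 := rfl
@[simp] theorem enc_some (a : α) : enc (some a) = .pair (.nat 1) (enc a) := rfl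
@[simp] theorem enc_true : enc true = Data.nat 1 := rfl
@[simp] theorem enc_false : enc false = Data.nat 0 := rfl
theorem mu_nat (n : ℕ) : mu n = Nat.size n + 1 := rfl
@[simp] theorem mu_bool (b : Bool) : mu b = 2 := rfl
@[simp] theorem mu_prod (x : α × β) : mu x = mu x.1 + mu x.2 + 1 := rfl
@[simp] theorem mu_nil : mu ([] : List α) = 1 := rfl
@[simp] theorem mu_cons (a : α) (l : List α) : mu (a :: l) = mu a + mu l + 1 := rfl
@[simp] theorem mu_none : mu (none : Option α) = 1 := rfl
@[simp] theorem mu_some (a : α) : mu (some a) = mu a + 3 := rfl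

theorem mu_append (l l' : List α) : mu (l ++ l') + 1 = mu l + mu l' := by
  induction l with
  | nil => simp [add_comm]
  | cons a l ih => simp only [List.cons_append, mu_cons]; omega

theorem mu_reverse (l : List α) : mu l.reverse = mu l := by
  induction l with
  | nil => rfl
  | cons a l ih =>
    have := mu_append l.reverse [a]
    simp only [List.reverse_cons, mu_cons, mu_nil] at this ⊢; omega

theorem mu_le_of_mem {a : α} {l : List α} (h : a ∈ l) : mu a ≤ mu l := by
  induction l with
  | nil => simp at h
  | cons b l ih =>
    rcases List.mem_cons.1 h with rfl | h
    · simp only [mu_cons]; omega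
    · have := ih h
      simp only [mu_cons]; omega

theorem length_lt_mu (l : List α) : l.length < mu l := by
  induction l with
  | nil => simp
  | cons b l ih => simp only [mu_cons, List.length_cons]; omega

theorem mu_le_of_forall_le {l : List α} {B : ℕ} (h : ∀ a ∈ l, mu a ≤ B) :
    mu l ≤ l.length * (B + 1) + 1 := by
  induction l with
  | nil => simp
  | cons b l ih =>
    have := ih fun a ha => h a (List.mem_cons_of_mem _ ha)
    have := h b List.mem_cons_self
    simp only [mu_cons, List.length_cons, add_mul]; omega

theorem mu_take_le (l : List α) (k : ℕ) : mu (l.take k) ≤ mu l := by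
  have := mu_append (l.take k) (l.drop k)
  rw [List.take_append_drop] at this
  have := mu_pos (l.drop k)
  omega

theorem mu_drop_le (l : List α) (k : ℕ) : mu (l.drop k) ≤ mu l := by
  have := mu_append (l.take k) (l.drop k)
  rw [List.take_append_drop] at this
  have := mu_pos (l.take k)
  omega

end EncLemmas

/-! ### Polynomial bounds in the measure -/

theorem _root_.Polynomial.eval_nat_mono (q : Polynomial ℕ) : Monotone fun n : ℕ => q.eval n := by
  intro m n h
  simp only [Polynomial.eval_eq_sum, Polynomial.sum]
  exact Finset.sum_le_sum fun i _ => Nat.mul_le_mul_left _ (Nat.pow_le_pow_left h i)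

/-- A function that is bounded by a polynomial in the measure of its argument. -/
def PolyBdd {α : Type} [Enc α] (g : α → ℕ) : Prop :=
  ∃ q : Polynomial ℕ, ∀ a, g a ≤ q.eval (mu a)

namespace PolyBdd
variable {α β : Type} [Enc α] [Enc β] {f g : α → ℕ}

theorem mono (hg : PolyBdd g) (h : ∀ a, f a ≤ g a) : PolyBdd f :=
  let ⟨q, hq⟩ := hg
  ⟨q, fun a => (h a).trans (hq a)⟩

theorem const (n : ℕ) : PolyBdd fun _ : α => n := ⟨Polynomial.C n, fun a => by simp⟩

theorem mu : PolyBdd fun a : α => Enc.mu a := ⟨Polynomial.X, fun a => by simp⟩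

theorem add (hf : PolyBdd f) (hg : PolyBdd g) : PolyBdd fun a => f a + g a :=
  let ⟨q, hq⟩ := hf
  let ⟨r, hr⟩ := hg
  ⟨q + r, fun a => by simpa using add_le_add (hq a) (hr a)⟩

theorem mul (hf : PolyBdd f) (hg : PolyBdd g) : PolyBdd fun a => f a * g a :=
  let ⟨q, hq⟩ := hf
  let ⟨r, hr⟩ := hg
  ⟨q * r, fun a => by simpa using Nat.mul_le_mul (hq a) (hr a)⟩

theorem eval (p : Polynomial ℕ) (hf : PolyBdd f) : PolyBdd fun a => p.eval (f a) :=
  let ⟨q, hq⟩ := hf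
  ⟨p.comp q, fun a => by simpa using p.eval_nat_mono (hq a)⟩

theorem comp {h : β → ℕ} (hh : PolyBdd h) {k : α → β} (hk : PolyBdd fun a => Enc.mu (k a)) :
    PolyBdd fun a => h (k a) :=
  let ⟨p, hp⟩ := hh
  (hk.eval p).mono fun _ => hp _

end PolyBdd

/-! ### Closure properties of polynomial-time functions -/

/-- `f` is computed by a program in time polynomial in the measure of the argument, and its
values have measure polynomial in the measure of the argument. -/
@[fun_prop]
def PolyTime {α β : Type} [Enc α] [Enc β] (f : α → β) : Prop :=
  PolyBdd (fun a => mu (f a)) ∧ ∃ (c : Code) (T : α → ℕ), PolyBdd T ∧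
    ∀ a, ∃ t ≤ T a, c.Runs (enc a) (enc (f a)) t

namespace PolyTime

section Basic
variable {α β γ δ : Type} [Enc α] [Enc β] [Enc γ] [Enc δ]

theorem of_enc_eq {f : α → β} (h : ∀ a, enc (f a) = enc a)
    (hB : PolyBdd fun a => mu (f a)) : PolyTime f :=
  ⟨hB, .prim .id, fun a => 1 + mu a + mu a,
    (((PolyBdd.const 1).add .mu).add .mu), fun a => ⟨_, by
      have := size_enc_le a
      exact Nat.add_le_add (Nat.add_le_add le_rfl this) this,
      by rw [h]; exact .prim .id _⟩⟩

@[fun_prop]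
theorem id : PolyTime fun a : α => a := of_enc_eq (fun _ => rfl) .mu

@[fun_prop]
theorem comp {g : β → γ} {f : α → β} (hg : PolyTime g) (hf : PolyTime f) :
    PolyTime fun a => g (f a) := by
  obtain ⟨hB, c, T, hT, h⟩ := hf
  obtain ⟨hB', c', T', hT', h'⟩ := hg
  refine ⟨hB'.comp hB, .seq c c', fun a => 1 + mu a + T a + T' (f a),
    (((PolyBdd.const 1).add .mu).add hT).add (hT'.comp hB), fun a => ?_⟩
  obtain ⟨t, ht, hr⟩ := h a
  obtain ⟨t', ht', hr'⟩ := h' (f a)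
  have := size_enc_le a
  exact ⟨_, by dsimp only; omega, .seq hr hr'⟩

@[fun_prop]
theorem prodMk {f : α → β} {g : α → γ} (hf : PolyTime f) (hg : PolyTime g) :
    PolyTime fun a => (f a, g a) := by
  obtain ⟨hB, c, T, hT, h⟩ := hf
  obtain ⟨hB', c', T', hT', h'⟩ := hg
  refine ⟨(hB.add hB').add (.const 1), .pair c c', fun a => 1 + mu a + T a + T' a,
    (((PolyBdd.const 1).add .mu).add hT).add hT', fun a => ?_⟩
  obtain ⟨t, ht, hr⟩ := h a
  obtain ⟨t', ht', hr'⟩ := h' a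
  have := size_enc_le a
  exact ⟨_, by dsimp only; omega, .pair hr hr'⟩

theorem prim_of_eq {f : α → β} (o : Prim) (ho : ∀ a, o.apply (enc a) = enc (f a))
    (hB : PolyBdd fun a => mu (f a)) : PolyTime f :=
  ⟨hB, .prim o, fun a => 1 + mu a + mu (f a), ((PolyBdd.const 1).add .mu).add hB, fun a =>
    ⟨1 + (enc a).size + (enc (f a)).size, by
      have := size_enc_le a
      have := size_enc_le (f a)
      dsimp only; omega, by simpa only [ho] using Code.Runs.prim o (enc a)⟩⟩

theorem fst' : PolyTime fun p : α × β => p.1 :=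
  prim_of_eq .fst (fun _ => rfl) (PolyBdd.mu.mono fun p => by simp only [mu_prod]; omega)

theorem snd' : PolyTime fun p : α × β => p.2 :=
  prim_of_eq .snd (fun _ => rfl) (PolyBdd.mu.mono fun p => by simp only [mu_prod]; omega)

@[fun_prop]
theorem fst {f : α → β × γ} (hf : PolyTime f) : PolyTime fun a => (f a).1 := comp fst' hf

@[fun_prop]
theorem snd {f : α → β × γ} (hf : PolyTime f) : PolyTime fun a => (f a).2 := comp snd' hf

/-- The program rebuilds `d` leaf by leaf; every step is charged for reading the input, so the time
is linear in its size. -/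
theorem exists_const_code (d : Data) : ∃ (c : Code) (k : ℕ), ∀ x : Data, ∃ t ≤ k * x.size,
    c.Runs x d t := by
  induction d with
  | nat n =>
    refine ⟨.prim (.const n), 2 + (Data.nat n).size, fun x => ⟨_, ?_, .prim _ x⟩⟩
    have := x.size_pos
    simp only [Prim.apply, add_mul]
    have := Nat.le_mul_of_pos_right (Data.nat n).size this
    omega
  | pair a b iha ihb =>
    obtain ⟨c, k, h⟩ := iha
    obtain ⟨c', k', h'⟩ := ihb
    refine ⟨.pair c c', 2 + k + k', fun x => ?_⟩
    obtain ⟨t, ht, hr⟩ := h x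
    obtain ⟨t', ht', hr'⟩ := h' x
    have := x.size_pos
    exact ⟨_, by simp only [add_mul]; omega, .pair hr hr'⟩

@[fun_prop]
theorem const (b : β) : PolyTime fun _ : α => b := by
  obtain ⟨c, k, h⟩ := exists_const_code (enc b)
  refine ⟨.const _, c, fun a => k * mu a, (PolyBdd.const k).mul .mu, fun a => ?_⟩
  obtain ⟨t, ht, hr⟩ := h (enc a)
  exact ⟨t, ht.trans (Nat.mul_le_mul_left _ (size_enc_le a)), hr⟩

theorem _root_.Nat.size_add_le (m n : ℕ) : Nat.size (m + n) ≤ Nat.size m + Nat.size n + 1 := by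
  rw [Nat.size_le]
  have h1 := Nat.lt_size_self m
  have h2 := Nat.lt_size_self n
  have h3 : 2 ^ m.size ≤ 2 ^ (m.size + n.size) := Nat.pow_le_pow_right (by norm_num) (by omega)
  have h4 : 2 ^ n.size ≤ 2 ^ (m.size + n.size) := Nat.pow_le_pow_right (by norm_num) (by omega)
  rw [pow_succ]; omega

theorem _root_.Nat.size_mul_le (m n : ℕ) : Nat.size (m * n) ≤ Nat.size m + Nat.size n := by
  rw [Nat.size_le, pow_add]
  exact Nat.mul_lt_mul'' (Nat.lt_size_self m) (Nat.lt_size_self n)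

@[fun_prop]
theorem add {f g : α → ℕ} (hf : PolyTime f) (hg : PolyTime g) : PolyTime fun a => f a + g a :=
  comp (g := fun p : ℕ × ℕ => p.1 + p.2) (prim_of_eq .add (fun _ => rfl)
    (PolyBdd.mu.mono fun p => by
      have := Nat.size_add_le p.1 p.2
      simp only [mu_prod, mu_nat]; omega)) (hf.prodMk hg)

@[fun_prop]
theorem sub {f g : α → ℕ} (hf : PolyTime f) (hg : PolyTime g) : PolyTime fun a => f a - g a :=
  comp (g := fun p : ℕ × ℕ => p.1 - p.2) (prim_of_eq .sub (fun _ => rfl)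
    (PolyBdd.mu.mono fun p => by
      have := Nat.size_le_size (Nat.sub_le p.1 p.2)
      simp only [mu_prod, mu_nat]; omega)) (hf.prodMk hg)

@[fun_prop]
theorem mul {f g : α → ℕ} (hf : PolyTime f) (hg : PolyTime g) : PolyTime fun a => f a * g a :=
  comp (g := fun p : ℕ × ℕ => p.1 * p.2) (prim_of_eq .mul (fun _ => rfl)
    (PolyBdd.mu.mono fun p => by
      have := Nat.size_mul_le p.1 p.2
      simp only [mu_prod, mu_nat]; omega)) (hf.prodMk hg)

@[fun_prop]
theorem div {f g : α → ℕ} (hf : PolyTime f) (hg : PolyTime g) : PolyTime fun a => f a / g a :=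
  comp (g := fun p : ℕ × ℕ => p.1 / p.2) (prim_of_eq .div (fun _ => rfl)
    (PolyBdd.mu.mono fun p => by
      have := Nat.size_le_size (Nat.div_le_self p.1 p.2)
      simp only [mu_prod, mu_nat]; omega)) (hf.prodMk hg)

/-- Branching on whether the encoding of a value is `nat 0`. -/
theorem branch {t : α → δ} {f : α → β} (ht : PolyTime t) (c₁ c₂ : Code) (T : α → ℕ)
    (hT : PolyBdd T) (hB : PolyBdd fun a => mu (f a))
    (h₁ : ∀ a, enc (t a) ≠ .nat 0 → ∃ s ≤ T a, c₁.Runs (enc a) (enc (f a)) s)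
    (h₂ : ∀ a, enc (t a) = .nat 0 → ∃ s ≤ T a, c₂.Runs (enc a) (enc (f a)) s) : PolyTime f := by
  obtain ⟨-, c, U, hU, h⟩ := ht
  refine ⟨hB, .cond c c₁ c₂, fun a => 1 + mu a + U a + T a,
    (((PolyBdd.const 1).add .mu).add hU).add hT, fun a => ?_⟩
  obtain ⟨s, hs, hr⟩ := h a
  have := size_enc_le a
  by_cases h0 : enc (t a) = .nat 0
  · obtain ⟨s', hs', hr'⟩ := h₂ a h0
    exact ⟨_, by dsimp only; omega, .cond_false (h0 ▸ hr) hr'⟩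
  · obtain ⟨s', hs', hr'⟩ := h₁ a h0
    exact ⟨_, by dsimp only; omega, .cond_true hr h0 hr'⟩

@[fun_prop]
theorem ite {p : α → Prop} [DecidablePred p] {f g : α → β} (hp : PolyTime fun a => decide (p a))
    (hf : PolyTime f) (hg : PolyTime g) : PolyTime fun a => if p a then f a else g a := by
  obtain ⟨hB, c, T, hT, h⟩ := hf
  obtain ⟨hB', c', T', hT', h'⟩ := hg
  refine branch hp c c' (fun a => T a + T' a) (hT.add hT') ((hB.add hB').mono fun a => ?_)
    (fun a ha => ?_) (fun a ha => ?_)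
  · split_ifs <;> simp
  · by_cases hpa : p a
    · obtain ⟨t, ht, hr⟩ := h a
      exact ⟨t, by omega, by rwa [if_pos hpa]⟩
    · simp [hpa] at ha
  · by_cases hpa : p a
    · simp [hpa] at ha
    · obtain ⟨t, ht, hr⟩ := h' a
      exact ⟨t, by omega, by rwa [if_neg hpa]⟩

/-- Case distinction on a list. -/
theorem listCases {l : α → List β} {f h : α → γ} {g : α × β × List β → γ} (hl : PolyTime l)
    (hf : PolyTime f) (hg : PolyTime g) (hnil : ∀ a, l a = [] → h a = f a)
    (hcons : ∀ a b l', l a = b :: l' → h a = g (a, b, l')) : PolyTime h := by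
  obtain ⟨hB, c, T, hT, hc⟩ := hf
  obtain ⟨hB', c', T', hT', hc'⟩ := hg
  obtain ⟨hB₁, c₁, T₁, hT₁, hc₁⟩ := id.prodMk hl
  obtain ⟨q, hq⟩ := hT'
  obtain ⟨r, hr⟩ := hB'
  refine branch hl (.seq c₁ c') c (fun a => T a + (1 + mu a + T₁ a + q.eval (mu (a, l a))))
    (hT.add ((((PolyBdd.const 1).add .mu).add hT₁).add (hB₁.eval q)))
    ((hB.add (hB₁.eval r)).mono fun a => ?_) (fun a ha => ?_) (fun a ha => ?_)
  · rcases hla : l a with _ | ⟨b, l'⟩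
    · simp [hnil a hla]
    · rw [hcons a b l' hla]
      have := hr (a, b, l')
      have e : mu (a, l a) = mu (a, b, l') := by rw [hla]; rfl
      dsimp only
      rw [e]
      exact this.trans (Nat.le_add_left _ _)
  · rcases hla : l a with _ | ⟨b, l'⟩
    · simp [hla] at ha
    · obtain ⟨t, ht, hr⟩ := hc₁ a
      obtain ⟨t', ht', hr'⟩ := hc' (a, b, l')
      dsimp only at hr
      rw [hla] at hr
      have := size_enc_le a
      have := hq (a, b, l')
      -- A nonempty list is encoded as the pair of its head and tail, so `(a, b :: l')` and `(a, b,
      -- l')` have the same encoding and no unpacking is needed.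
      have e : mu (a, b, l') = mu (a, b :: l') := rfl
      rw [e] at this
      rw [hcons a b l' hla]
      exact ⟨_, by omega, .seq hr hr'⟩
  · rcases hla : l a with _ | ⟨b, l'⟩
    · obtain ⟨t, ht, hr⟩ := hc a
      rw [hnil a hla]
      exact ⟨t, by omega, hr⟩
    · simp [hla] at ha

/-- A program sees only encodings, so it serves both functions; the measure of the new type may be
larger and has to be bounded anew. -/
theorem congr_enc {f : α → β} {g : α → γ} (hf : PolyTime f) (h : ∀ a, enc (g a) = enc (f a))
    (hB : PolyBdd fun a => mu (g a)) : PolyTime g := by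
  obtain ⟨-, c, T, hT, hc⟩ := hf
  exact ⟨hB, c, T, hT, fun a => h a ▸ hc a⟩

@[fun_prop]
theorem cons {f : α → β} {l : α → List β} (hf : PolyTime f) (hl : PolyTime l) :
    PolyTime fun a => f a :: l a :=
  comp (g := fun p : β × List β => p.1 :: p.2) (of_enc_eq (fun _ => rfl) .mu) (hf.prodMk hl)

@[fun_prop]
theorem some {f : α → β} (hf : PolyTime f) : PolyTime fun a => some (f a) :=
  ((const 1).prodMk hf).congr_enc (fun _ => rfl) (hf.1.add (.const 3))

/-- Iteration of a step as long as a test succeeds. -/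
theorem iterate {init : α → γ} {step : γ → γ} {test : γ → Bool} (N B : α → ℕ)
    (hinit : PolyTime init) (hstep : PolyTime step) (htest : PolyTime test) (hN : PolyBdd N)
    (hB : PolyBdd B) (hmu : ∀ a, ∀ k ≤ N a, mu (step^[k] (init a)) ≤ B a)
    (htrue : ∀ a, ∀ k < N a, test (step^[k] (init a)) = true)
    (hfalse : ∀ a, test (step^[N a] (init a)) = false) :
    PolyTime fun a => step^[N a] (init a) := by
  obtain ⟨hBi, ci, Ti, hTi, hi⟩ := hinit
  obtain ⟨-, cs, Ts, ⟨qs, hqs⟩, hs⟩ := hstep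
  obtain ⟨-, ct, Tt, ⟨qt, hqt⟩, ht⟩ := htest
  let M : α → ℕ := fun a => 1 + B a + qt.eval (B a) + qs.eval (B a)
  -- The starting state is arbitrary so that the induction on the number of remaining rounds can
  -- pass to `step s`; `M a` bounds the cost of one round.
  have key : ∀ (a : α) (n : ℕ) (s : γ), (∀ k ≤ n, mu (step^[k] s) ≤ B a) →
      (∀ k < n, test (step^[k] s) = true) → test (step^[n] s) = false →
      ∃ t ≤ (n + 1) * M a, (Code.loop ct cs).Runs (enc s) (enc (step^[n] s)) t := by
    intro a n
    induction n with
    | zero =>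
      intro s h1 _ h3
      obtain ⟨t, ht', hr⟩ := ht s
      have h0 : mu s ≤ B a := h1 0 le_rfl
      have := size_enc_le s
      have := (hqt s).trans (qt.eval_nat_mono h0)
      rw [show test s = false from h3] at hr
      refine ⟨1 + (enc s).size + t, by dsimp only [M] at *; omega, ?_⟩
      constructor
      exact hr
    | succ n ih =>
      intro s h1 h2 h3
      obtain ⟨u, hu, hru⟩ := ih (step s) (fun k hk => h1 (k + 1) (by omega))
        (fun k hk => h2 (k + 1) (by omega)) h3
      obtain ⟨t, ht', hr⟩ := ht s
      obtain ⟨t', ht'', hr'⟩ := hs s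
      have h0 : mu s ≤ B a := h1 0 (by omega)
      have := size_enc_le s
      have := (hqt s).trans (qt.eval_nat_mono h0)
      have := (hqs s).trans (qs.eval_nat_mono h0)
      rw [show test s = true from h2 0 (by omega)] at hr
      refine ⟨_, ?_, .loop_step hr (by simp) hr' hru⟩
      rw [add_mul _ 1, one_mul]
      dsimp only [M] at *; omega
  refine ⟨hB.mono fun a => hmu a _ le_rfl, .seq ci (.loop ct cs),
    fun a => 1 + mu a + Ti a + (N a + 1) * M a,
    (((PolyBdd.const 1).add .mu).add hTi).add ((hN.add (.const 1)).mul
      ((((PolyBdd.const 1).add hB).add (hB.eval qt)).add (hB.eval qs))), fun a => ?_⟩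
  obtain ⟨t, ht', hr⟩ := hi a
  obtain ⟨u, hu, hru⟩ := key a (N a) (init a) (hmu a) (htrue a) (hfalse a)
  have := size_enc_le a
  exact ⟨_, by dsimp only; omega, .seq hr hru⟩

/-- Left folds whose intermediate results are polynomially bounded. -/
theorem foldl {l : α → List β} {i : α → γ} {g : α → γ → β → γ} (B : α → ℕ) (hl : PolyTime l)
    (hi : PolyTime i) (hg : PolyTime fun p : α × γ × β => g p.1 p.2.1 p.2.2)
    (hB : PolyBdd B) (hmu : ∀ a k, mu (((l a).take k).foldl (g a) (i a)) ≤ B a) :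
    PolyTime fun a => (l a).foldl (g a) (i a) := by
  -- A loop body sees nothing but the state, which therefore carries the parameter along with the
  -- accumulator and the unread part of the list.
  let step : α × γ × List β → α × γ × List β := fun s =>
    match s.2.2 with
    | [] => s
    | b :: l' => (s.1, g s.1 s.2.1 b, l')
  have hstep : PolyTime step := by
    refine listCases (l := fun s => s.2.2) (f := fun s => s)
      (g := fun p => (p.1.1, g p.1.1 p.1.2.1 p.2.1, p.2.2)) (by fun_prop) (by fun_prop)
      ?_ ?_ ?_
    · have := hg.comp (f := fun p : (α × γ × List β) × β × List β => (p.1.1, p.1.2.1, p.2.1))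
        (by fun_prop)
      exact (by fun_prop : PolyTime fun p : (α × γ × List β) × β × List β => p.1.1).prodMk
        (this.prodMk (by fun_prop))
    · intro a h; simp only [step]; rw [h]
    · intro a b l' h; simp only [step]; rw [h]
  have hiter : ∀ a k, step^[k] (a, i a, l a) =
      (a, ((l a).take k).foldl (g a) (i a), (l a).drop k) := by
    intro a k
    induction k with
    | zero => simp
    | succ k ih =>
      rw [Function.iterate_succ_apply', ih]
      simp only [step]
      rcases h : (l a).drop k with _ | ⟨b, l'⟩
      · have := List.drop_eq_nil_iff.1 h
        simp [List.take_of_length_le this, List.take_of_length_le (this.trans k.le_succ), this.trans k.le_succ]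
      · have hk : k < (l a).length := by
          by_contra hk
          rw [List.drop_eq_nil_iff.2 (by omega)] at h
          simp at h
        rw [List.drop_eq_getElem_cons hk, List.cons.injEq] at h
        simp [List.take_add_one, List.foldl_append, List.getElem?_eq_getElem hk, h.1, h.2]
  have hlen := hl.1.mono fun a => (length_lt_mu (l a)).le
  have := iterate (init := fun a => (a, i a, l a)) (step := step)
    (test := fun s => !s.2.2.isEmpty) (fun a => (l a).length)
    (fun a => mu a + (B a + mu (l a) + 1) + 1) (by fun_prop) hstep
    (listCases (l := fun s => s.2.2) (f := fun _ => false) (g := fun _ => true) (by fun_prop)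
      (by fun_prop) (by fun_prop) (by intro a h; simp [h]) (by intro a b l' h; simp [h])) hlen
    ((PolyBdd.mu.add ((hB.add hl.1).add (.const 1))).add (.const 1))
    (fun a k _ => by
      rw [hiter]
      have := hmu a k
      have := mu_drop_le (l a) k
      simp only [mu_prod]; omega)
    (fun a k hk => by
      rw [hiter]; simpa using hk)
    (fun a => by rw [hiter]; simp)
  simp only [hiter] at this
  simpa using this.snd.fst

end Basic

/-! ### Polynomial-time list operations -/

section Lists
variable {α β γ δ : Type} [Enc α] [Enc β] [Enc γ] [Enc δ]

@[fun_prop]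
theorem isEmpty {l : α → List β} (hl : PolyTime l) : PolyTime fun a => (l a).isEmpty :=
  listCases (f := fun _ => true) (g := fun _ => false) hl (by fun_prop) (by fun_prop)
    (by intro a h; simp [h]) (by intro a b l' h; simp [h])

@[fun_prop]
theorem headD {l : α → List β} {d : α → β} (hl : PolyTime l) (hd : PolyTime d) :
    PolyTime fun a => (l a).headD (d a) :=
  listCases (f := d) (g := fun p => p.2.1) hl hd (by fun_prop)
    (by intro a h; simp [h]) (by intro a b l' h; simp [h])

@[fun_prop]
theorem tail {l : α → List β} (hl : PolyTime l) : PolyTime fun a => (l a).tail :=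
  listCases (f := fun _ => []) (g := fun p => p.2.2) hl (by fun_prop) (by fun_prop)
    (by intro a h; simp [h]) (by intro a b l' h; simp [h])

@[fun_prop]
theorem reverse {l : α → List β} (hl : PolyTime l) : PolyTime fun a => (l a).reverse := by
  have h : ∀ l : List β, l.reverse = l.foldl (fun acc x => x :: acc) [] := by simp
  simp only [h]
  refine foldl (g := fun _ acc x => x :: acc) (fun a => mu (l a)) hl (by fun_prop) (by fun_prop)
    hl.1 fun a k => ?_
  rw [← h, mu_reverse]
  exact mu_take_le _ _

@[fun_prop]
theorem append {l l' : α → List β} (hl : PolyTime l) (hl' : PolyTime l') :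
    PolyTime fun a => l a ++ l' a := by
  have h : ∀ l l' : List β, l.foldl (fun acc x => x :: acc) l' = l.reverse ++ l' := by simp
  have := foldl (l := fun a => (l a).reverse) (i := l') (g := fun _ acc x => x :: acc)
    (fun a => mu (l a) + mu (l' a)) (by fun_prop) hl' (by fun_prop) (hl.1.add hl'.1) fun a k => by
      have h1 := mu_append ((l a).reverse.take k).reverse (l' a)
      have h2 := mu_take_le (l a).reverse k
      rw [mu_reverse] at h1 h2
      rw [h]; omega
  simpa only [h, List.reverse_reverse] using this

@[fun_prop]
theorem map {l : α → List β} {g : α → β → γ} (hg : PolyTime fun p : α × β => g p.1 p.2)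
    (hl : PolyTime l) : PolyTime fun a => (l a).map (g a) := by
  have h : ∀ (f : β → γ) (l : List β) (acc : List γ),
      l.foldl (fun acc x => f x :: acc) acc = (l.map f).reverse ++ acc := by
    intro f l
    induction l with
    | nil => simp
    | cons x l ih => intro acc; simp [ih]
  obtain ⟨q, hq⟩ := hg.1
  have hlen := hl.1.mono fun a => (length_lt_mu (l a)).le
  have := foldl (l := l) (i := fun _ => []) (g := fun a acc x => g a x :: acc)
    (fun a => (l a).length * (q.eval (mu a + mu (l a) + 1) + 1) + 1) hl (by fun_prop)
    ((hg.comp (f := fun p : α × List γ × β => (p.1, p.2.2)) (by fun_prop)).cons (by fun_prop))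
    ((hlen.mul ((((PolyBdd.mu.add hl.1).add (.const 1)).eval q).add (.const 1))).add (.const 1))
    fun a k => by
      rw [h, List.append_nil, mu_reverse]
      refine (mu_le_of_forall_le (B := q.eval (mu a + mu (l a) + 1)) ?_).trans ?_
      · intro c hc
        obtain ⟨b, hb, rfl⟩ := List.mem_map.1 hc
        refine (hq (a, b)).trans (q.eval_nat_mono ?_)
        have := mu_le_of_mem (List.mem_of_mem_take hb)
        simp only [mu_prod]; omega
      · simp only [List.length_map, List.length_take]
        gcongr
        exact min_le_right _ _
  simp only [h, List.append_nil] at this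
  simpa using this.reverse

@[fun_prop]
theorem flatten {l : α → List (List β)} (hl : PolyTime l) : PolyTime fun a => (l a).flatten := by
  have h : ∀ (l : List (List β)) (acc : List β),
      l.foldl (fun acc x => acc ++ x) acc = acc ++ l.flatten := by
    intro l
    induction l with
    | nil => simp
    | cons x l ih => intro acc; simp [ih]
  have hmu : ∀ l : List (List β), mu l.flatten ≤ mu l := by
    intro l
    induction l with
    | nil => simp
    | cons x l ih =>
      have := mu_append x l.flatten
      simp only [List.flatten_cons, mu_cons]; omega
  have := foldl (l := l) (i := fun _ => []) (g := fun _ acc x => acc ++ x)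
    (fun a => mu (l a)) hl (by fun_prop) (by fun_prop) hl.1 fun a k => by
      rw [h, List.nil_append]
      exact (hmu _).trans (mu_take_le _ _)
  simpa only [h, List.nil_append] using this

@[fun_prop]
theorem flatMap {l : α → List β} {g : α → β → List γ} (hg : PolyTime fun p : α × β => g p.1 p.2)
    (hl : PolyTime l) : PolyTime fun a => (l a).flatMap (g a) := by
  simp only [List.flatMap_def]
  exact (map hg hl).flatten

end Lists

/-! ### Polynomial-time tests -/

section Decide
variable {α β : Type} [Enc α] [Enc β]

theorem decide_of_iff {p q : α → Prop} [DecidablePred p] [DecidablePred q]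
    (hp : PolyTime fun a => decide (p a)) (h : ∀ a, q a ↔ p a) : PolyTime fun a => decide (q a) := by
  simpa only [h] using hp

@[fun_prop]
theorem decide_le {f g : α → ℕ} (hf : PolyTime f) (hg : PolyTime g) :
    PolyTime fun a => decide (f a ≤ g a) := by
  -- Truncated subtraction vanishes exactly when `f a ≤ g a`.
  refine branch (hf.sub hg) (.prim (.const 0)) (.prim (.const 1)) (fun a => 1 + mu a + 2)
    (((PolyBdd.const 1).add .mu).add (.const 2)) (PolyBdd.const 2) (fun a h => ?_) (fun a h => ?_)
  · have h' : ¬ f a ≤ g a := fun h' => h (by simp [Nat.sub_eq_zero_of_le h'])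
    simp only [h', decide_false]
    have := size_enc_le a
    exact ⟨_, by simp [Prim.apply, Data.size]; omega, .prim (.const 0) _⟩
  · have h' : f a ≤ g a := by
      simp only [enc_nat, Data.nat.injEq] at h; omega
    simp only [h', decide_true]
    have := size_enc_le a
    exact ⟨_, by simp [Prim.apply, Data.size]; omega, .prim (.const 1) _⟩

@[fun_prop]
theorem decide_not {p : α → Prop} [DecidablePred p] [∀ a, Decidable (¬ p a)]
    (hp : PolyTime fun a => decide (p a)) :
    PolyTime fun a => decide (¬ p a) := by
  have : (fun a => decide (¬ p a)) = fun a => if p a then false else true := by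
    funext a; by_cases h : p a <;> simp [h]
  rw [this]; exact ite hp (const _) (const _)

@[fun_prop]
theorem decide_and {p q : α → Prop} [DecidablePred p] [DecidablePred q]
    [∀ a, Decidable (p a ∧ q a)] (hp : PolyTime fun a => decide (p a))
    (hq : PolyTime fun a => decide (q a)) : PolyTime fun a => decide (p a ∧ q a) := by
  have : (fun a => decide (p a ∧ q a)) = fun a => if p a then decide (q a) else false := by
    funext a; by_cases h : p a <;> simp [h]
  rw [this]; exact ite hp hq (const _)

@[fun_prop]
theorem decide_or {p q : α → Prop} [DecidablePred p] [DecidablePred q]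
    [∀ a, Decidable (p a ∨ q a)] (hp : PolyTime fun a => decide (p a))
    (hq : PolyTime fun a => decide (q a)) : PolyTime fun a => decide (p a ∨ q a) := by
  have : (fun a => decide (p a ∨ q a)) = fun a => if p a then true else decide (q a) := by
    funext a; by_cases h : p a <;> simp [h]
  rw [this]; exact ite hp (const _) hq

@[fun_prop]
theorem decide_lt {f g : α → ℕ} (hf : PolyTime f) (hg : PolyTime g) :
    PolyTime fun a => decide (f a < g a) :=
  decide_of_iff (decide_not (decide_le hg hf)) fun _ => not_le.symm

@[fun_prop]
theorem decide_eq {f g : α → ℕ} (hf : PolyTime f) (hg : PolyTime g) :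
    PolyTime fun a => decide (f a = g a) :=
  decide_of_iff (decide_and (decide_le hf hg) (decide_le hg hf)) fun _ => le_antisymm_iff

@[fun_prop]
theorem decide_bool {f : α → Bool} (hf : PolyTime f) : PolyTime fun a => decide (f a = true) := by
  simpa using hf

@[fun_prop]
theorem min {f g : α → ℕ} (hf : PolyTime f) (hg : PolyTime g) :
    PolyTime fun a => min (f a) (g a) := by
  simp only [min_def]
  exact ite (decide_le hf hg) hf hg

end Decide

/-! ### Sums, products, ranges and list lookup -/

section Numbers
variable {α β : Type} [Enc α] [Enc β]

@[fun_prop]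
theorem filter {l : α → List β} {p : α → β → Bool} (hp : PolyTime fun x : α × β => p x.1 x.2)
    (hl : PolyTime l) : PolyTime fun a => (l a).filter (p a) := by
  have h : ∀ (l : List β) (f : β → Bool), l.filter f = l.flatMap fun x => if f x then [x] else [] := by
    intro l f
    induction l with
    | nil => simp
    | cons x l ih => by_cases hx : f x <;> simp [hx, ih]
  simp only [h]
  exact flatMap (g := fun a x => if p a x then [x] else []) (by fun_prop) hl

theorem _root_.Nat.size_sum_le (l : List ℕ) : Nat.size l.sum + 1 ≤ mu l := by
  induction l with
  | nil => simp
  | cons x l ih =>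
    have := Nat.size_add_le x l.sum
    simp only [List.sum_cons, mu_cons, mu_nat]; omega

theorem _root_.Nat.size_prod_le (l : List ℕ) : Nat.size l.prod ≤ mu l := by
  induction l with
  | nil => simp
  | cons x l ih =>
    have := Nat.size_mul_le x l.prod
    simp only [List.prod_cons, mu_cons, mu_nat]; omega

@[fun_prop]
theorem sum {l : α → List ℕ} (hl : PolyTime l) : PolyTime fun a => (l a).sum := by
  simp only [List.sum_eq_foldl]
  refine foldl (g := fun _ acc x => acc + x) (fun a => mu (l a)) hl (by fun_prop) (by fun_prop)
    hl.1 fun a k => ?_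
  rw [← List.sum_eq_foldl]
  exact (Nat.size_sum_le _).trans (mu_take_le _ _)

@[fun_prop]
theorem prod {l : α → List ℕ} (hl : PolyTime l) : PolyTime fun a => (l a).prod := by
  simp only [List.prod_eq_foldl]
  refine foldl (g := fun _ acc x => acc * x) (fun a => mu (l a) + 1) hl (by fun_prop)
    (by fun_prop) (hl.1.add (.const 1)) fun a k => ?_
  rw [← List.prod_eq_foldl]
  exact Nat.add_le_add_right ((Nat.size_prod_le _).trans (mu_take_le _ _)) 1

@[fun_prop]
theorem length {l : α → List β} (hl : PolyTime l) : PolyTime fun a => (l a).length := by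
  have : ∀ l : List β, l.length = (l.map fun _ => 1).sum := by simp
  simp only [this]
  fun_prop

theorem _root_.Nat.size_le_self (n : ℕ) : Nat.size n ≤ n := Nat.size_le.2 Nat.lt_two_pow_self

/-- Numbers that are polynomially bounded in value can be enumerated from `0`. -/
theorem range {f : α → ℕ} (hf : PolyTime f) (hB : PolyBdd f) :
    PolyTime fun a => List.range (f a) := by
  -- Counting down while prepending yields the list in increasing order.
  let step : ℕ × List ℕ → ℕ × List ℕ := fun s => (s.1 - 1, (s.1 - 1) :: s.2)
  have h : ∀ n k, k ≤ n → step^[k] (n, []) = (n - k, List.range' (n - k) k) := by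
    intro n k
    induction k with
    | zero => simp
    | succ k ih =>
      intro hk
      rw [Function.iterate_succ_apply', ih (by omega)]
      have e : n - k = n - (k + 1) + 1 := by omega
      simp only [step, List.range'_succ, ← e]
      simp [Nat.sub_sub]
  have := iterate (init := fun a => (f a, ([] : List ℕ))) (step := step)
    (test := fun s => decide (¬ s.1 ≤ 0)) f (fun a => (f a + 1) + (f a * (f a + 2) + 1) + 1)
    (by fun_prop) (by fun_prop) (by fun_prop) hB
    (((hB.add (.const 1)).add ((hB.mul (hB.add (.const 2))).add (.const 1))).add (.const 1))
    (fun a k hk => by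
      rw [h _ _ hk]
      have h1 := mu_le_of_forall_le (l := List.range' (f a - k) k) (B := f a + 1) (by
        intro n hn
        have := Nat.size_le_self n
        rw [List.mem_range'_1] at hn
        rw [mu_nat]; omega)
      have h2 := Nat.size_le_self (f a - k)
      have h3 := Nat.mul_le_mul_right (f a + 2) hk
      rw [List.length_range'] at h1
      simp only [mu_prod, mu_nat]
      simp only [add_assoc, one_add_one_eq_two] at h1
      omega)
    (fun a k hk => by rw [h _ _ hk.le]; simp; omega)
    (fun a => by rw [h _ _ le_rfl]; simp)
  simp only [h _ _ le_rfl] at this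
  simpa [List.range_eq_range'] using this.snd

theorem sum_range {n : α → ℕ} {f : α → ℕ → ℕ} (hn : PolyTime fun a => List.range (n a))
    (hf : PolyTime fun p : α × ℕ => f p.1 p.2) :
    PolyTime fun a => ∑ i ∈ Finset.range (n a), f a i := by
  have : ∀ (n : ℕ) (f : ℕ → ℕ), ∑ i ∈ Finset.range n, f i = ((List.range n).map f).sum := by
    intro n f
    induction n with
    | zero => simp
    | succ n ih => simp [Finset.sum_range_succ, List.range_succ, ih]
  simp only [this]
  fun_prop

@[fun_prop]
theorem getD {l : α → List β} {i : α → ℕ} {d : α → β} (hl : PolyTime l) (hi : PolyTime i)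
    (hd : PolyTime d) : PolyTime fun a => (l a).getD (i a) (d a) := by
  -- The counter starts at `i + 1` and the entry met at value `1` is taken; truncated subtraction
  -- then keeps it at `0`, so nothing is taken later.
  have h : ∀ (d : β) (l : List β) (i : ℕ), (l.foldl (fun (s : ℕ × β) x =>
      (s.1 - 1, if s.1 = 1 then x else s.2)) (i + 1, d)).2 = l.getD i d := by
    have h0 : ∀ (l : List β) (d : β), (l.foldl (fun (s : ℕ × β) x =>
      (s.1 - 1, if s.1 = 1 then x else s.2)) (0, d)).2 = d := by
      intro l
      induction l with
      | nil => simp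
      | cons x l ih => intro d; simpa using ih d
    intro d l
    induction l with
    | nil => simp
    | cons x l ih =>
      intro i
      rcases i with _ | i
      · simpa using h0 l x
      · simpa using ih i
  have hbd : ∀ (B : ℕ) (l : List β) (s : ℕ × β), (∀ x ∈ l, mu x ≤ B) → mu s.2 ≤ B →
      (l.foldl (fun (s : ℕ × β) x => (s.1 - 1, if s.1 = 1 then x else s.2)) s).1 ≤ s.1 ∧
      mu (l.foldl (fun (s : ℕ × β) x => (s.1 - 1, if s.1 = 1 then x else s.2)) s).2 ≤ B := by
    intro B l
    induction l with
    | nil => intro s _ h; exact ⟨le_rfl, h⟩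
    | cons x l ih =>
      intro s h1 h2
      have := ih (s.1 - 1, if s.1 = 1 then x else s.2) (fun y hy => h1 y (List.mem_cons_of_mem _ hy))
        (by dsimp only; split_ifs
            · exact h1 x List.mem_cons_self
            · exact h2)
      exact ⟨this.1.trans (Nat.sub_le _ _), this.2⟩
  have := foldl (l := l) (i := fun a => (i a + 1, d a))
    (g := fun _ (s : ℕ × β) x => (s.1 - 1, if s.1 = 1 then x else s.2))
    (fun a => mu (i a + 1) + (mu (d a) + mu (l a)) + 1) hl (by fun_prop) (by fun_prop)
    (((hi.add (const 1)).1.add (hd.1.add hl.1)).add (.const 1))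
    (fun a k => by
      have := hbd (mu (d a) + mu (l a)) ((l a).take k) (i a + 1, d a)
        (fun x hx => (mu_le_of_mem (List.mem_of_mem_take hx)).trans (Nat.le_add_left _ _))
        (Nat.le_add_right _ _)
      have h1 := Nat.size_le_size this.1
      simp only [mu_prod, mu_nat] at this h1 ⊢
      omega)
  simpa only [h] using this.snd

end Numbers

end PolyTime
-- Instances read and written as nested lists
/-- Encodings whose measure is at most twice the encoding size. -/
class StdEnc (α : Type) [Enc α] : Prop where
  mu_le : ∀ a : α, mu a ≤ 2 * (enc a).size

instance : StdEnc ℕ := ⟨fun n => by simp [mu_nat, Data.size]⟩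

instance : StdEnc Bool := ⟨fun b => by cases b <;> simp [Data.size]⟩

instance {α β : Type} [Enc α] [Enc β] [StdEnc α] [StdEnc β] : StdEnc (α × β) := ⟨fun x => by
  have := StdEnc.mu_le x.1
  have := StdEnc.mu_le x.2
  simp only [mu_prod, enc_prod, Data.size]; omega⟩

instance {α : Type} [Enc α] [StdEnc α] : StdEnc (List α) := ⟨fun l => by
  induction l with
  | nil => simp [Data.size]
  | cons a l ih =>
    have := StdEnc.mu_le a
    simp only [mu_cons, enc_cons, Data.size]; omega⟩

/-- The identity program reinterprets the data. Since the new measure is at most twice the encoding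
size, no separate bound is required. -/
theorem PolyTime.of_enc_eq_std {α β : Type} [Enc α] [Enc β] [StdEnc β] {f : α → β}
    (h : ∀ a, enc (f a) = enc a) : PolyTime f :=
  .of_enc_eq h (((PolyBdd.const 2).mul .mu).mono fun a => (StdEnc.mu_le _).trans
    (Nat.mul_le_mul_left _ (h a ▸ size_enc_le a)))

theorem ofVec_eq_enc {α β : Type} [Enc β] {n : ℕ} (e : α → Data) (x : Fin n → α) (y : Fin n → β)
    (h : ∀ i, e (x i) = enc (y i)) : Data.ofVec e x = enc (List.ofFn y) := by
  have : enc (List.ofFn y) = Data.ofList ((List.ofFn y).map enc) := rfl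
  rw [this, List.map_ofFn, Data.ofVec]
  congr 2
  funext i
  exact h i

theorem ofFn_eq_map_range {β : Type} (n : ℕ) (f : ℕ → β) :
    List.ofFn (fun i : Fin n => f i) = (List.range n).map f := by
  apply List.ext_getElem <;> simp

/-- Numerator and denominator of a nonnegative rational number. -/
def ratPair (q : ℚ) : ℕ × ℕ := (q.num.natAbs, q.den)

theorem enc_ratPair (q : ℚ) : Data.ofRat q = enc (ratPair q) := rfl

/-- The largest number enters by value, so polynomial in this measure means pseudopolynomial. -/
noncomputable instance (P : DiscreteProblem) (K : ℕ) : Enc (ExactInstance P K) :=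
  ⟨(exactProblem P K).encode, fun J => ((exactProblem P K).encode J).size +
    (exactProblem P K).maxNumber J, fun _ => Nat.le_add_right _ _⟩

/-- The inputs of an approximation scheme for Min-WOWA. -/
structure SchemeInput (P : DiscreteProblem) (K : ℕ) where
  J : WowaInstance P K
  ε : ℚ
  ε_pos : 0 < ε

/-- The term `⌈1 / a.ε⌉₊` gives the time bound of an approximation scheme. -/
noncomputable instance (P : DiscreteProblem) (K : ℕ) : Enc (SchemeInput P K) :=
  ⟨fun a => (minWowa P K).schemeInput a.J a.ε,
    fun a => ((minWowa P K).schemeInput a.J a.ε).size + ⌈1 / a.ε⌉₊, fun _ => Nat.le_add_right _ _⟩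

namespace SchemeInput

variable {P : DiscreteProblem} {K : ℕ} {α : Type} [Enc α]

/-- The bit string that describes the underlying instance. -/
def bits (a : SchemeInput P K) : List Bool := P.encoding.encode a.J.inst

/-- The costs as pairs of numerators and denominators. -/
def costL (a : SchemeInput P K) : List (List (ℕ × ℕ)) :=
  List.ofFn fun j => List.ofFn fun i => ratPair (a.J.cost j i)

/-- The weights as pairs of numerators and denominators. -/
def vL (a : SchemeInput P K) : List (ℕ × ℕ) := List.ofFn fun j => ratPair (a.J.v j)

/-- The probabilities as pairs of numerators and denominators. -/
def pL (a : SchemeInput P K) : List (ℕ × ℕ) := List.ofFn fun j => ratPair (a.J.p j)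

theorem polyTime_raw : PolyTime fun a : SchemeInput P K =>
    ((a.bits, a.costL, a.vL, a.pL), ratPair a.ε) := by
  refine .of_enc_eq_std fun a => ?_
  have e : enc a = .pair (.pair (Data.ofBits a.bits)
    (.pair (Data.ofVec (Data.ofVec Data.ofRat) a.J.cost)
      (.pair (Data.ofVec Data.ofRat a.J.v) (Data.ofVec Data.ofRat a.J.p)))) (Data.ofRat a.ε) := rfl
  rw [e, ofVec_eq_enc (Data.ofVec Data.ofRat) _ _ fun j => ofVec_eq_enc Data.ofRat _ _ fun i =>
    enc_ratPair _, ofVec_eq_enc Data.ofRat _ _ fun i => enc_ratPair _,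
    ofVec_eq_enc Data.ofRat _ _ fun i => enc_ratPair _]
  rfl

@[fun_prop]
theorem polyTime_bits {f : α → SchemeInput P K} (hf : PolyTime f) : PolyTime fun x => (f x).bits :=
  polyTime_raw.fst.fst.comp hf

@[fun_prop]
theorem polyTime_costL {f : α → SchemeInput P K} (hf : PolyTime f) :
    PolyTime fun x => (f x).costL :=
  polyTime_raw.fst.snd.fst.comp hf

@[fun_prop]
theorem polyTime_vL {f : α → SchemeInput P K} (hf : PolyTime f) : PolyTime fun x => (f x).vL :=
  polyTime_raw.fst.snd.snd.fst.comp hf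

@[fun_prop]
theorem polyTime_pL {f : α → SchemeInput P K} (hf : PolyTime f) : PolyTime fun x => (f x).pL :=
  polyTime_raw.fst.snd.snd.snd.comp hf

theorem polyTime_eps : PolyTime fun x : SchemeInput P K => ratPair x.ε := polyTime_raw.snd

/-- The number of elements. -/
def n (a : SchemeInput P K) : ℕ := P.numElements a.J.inst

@[fun_prop]
theorem polyTime_n [NeZero K] {f : α → SchemeInput P K} (hf : PolyTime f) :
    PolyTime fun x => (f x).n := by
  -- The encoding does not state the number of elements; it is the length of the first cost vector,
  -- which exists because `K ≠ 0`.
  have h : ∀ a : SchemeInput P K, a.n = (a.costL.headD []).length := by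
    intro a
    obtain ⟨k, rfl⟩ := Nat.exists_eq_succ_of_ne_zero (NeZero.ne K)
    simp [costL, n, List.ofFn_succ]
  simp only [h]
  fun_prop

theorem polyBdd_n [NeZero K] : PolyBdd (n : SchemeInput P K → ℕ) := by
  have h : ∀ a : SchemeInput P K, a.n = (a.costL.headD []).length := by
    intro a
    obtain ⟨k, rfl⟩ := Nat.exists_eq_succ_of_ne_zero (NeZero.ne K)
    simp [costL, n, List.ofFn_succ]
  exact (by fun_prop : PolyTime fun a : SchemeInput P K => a.costL.headD []).1.mono fun a =>
    (h a).le.trans (length_lt_mu _).le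

@[fun_prop]
theorem polyTime_range_n [NeZero K] {f : α → SchemeInput P K} (hf : PolyTime f) :
    PolyTime fun x => List.range (f x).n :=
  (PolyTime.range (by fun_prop : PolyTime fun a : SchemeInput P K => a.n) polyBdd_n).comp hf

/-! ### Accuracy parameters -/

/-- A natural number that is at least `1 / ε`. -/
def m (a : SchemeInput P K) : ℕ := (ratPair a.ε).2 / (ratPair a.ε).1 + 1

theorem one_div_eps (a : SchemeInput P K) :
    1 / a.ε = ((ratPair a.ε).2 : ℚ) / ((ratPair a.ε).1 : ℚ) := by
  have h := Rat.num_pos.2 a.ε_pos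
  have h' : (a.ε.num.natAbs : ℤ) = a.ε.num := Int.natAbs_of_nonneg h.le
  have h'' : ((a.ε.num.natAbs : ℕ) : ℚ) = a.ε.num := by
    rw [← Int.cast_natCast, h']
  simp only [ratPair, h'']
  conv_lhs => rw [← Rat.num_div_den a.ε]
  rw [one_div_div]

theorem one_div_eps_le (a : SchemeInput P K) : 1 / a.ε ≤ a.m := by
  have h := Rat.num_pos.2 a.ε_pos
  have h1 : 0 < (ratPair a.ε).1 := Int.natAbs_pos.2 h.ne'
  rw [one_div_eps, div_le_iff₀ (by exact_mod_cast h1), m]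
  have := Nat.lt_div_mul_add h1 (a := (ratPair a.ε).2)
  have h2 : (ratPair a.ε).2 ≤ ((ratPair a.ε).2 / (ratPair a.ε).1 + 1) * (ratPair a.ε).1 := by
    rw [add_mul, one_mul]; exact this.le
  exact_mod_cast h2

theorem m_le (a : SchemeInput P K) : a.m ≤ ⌈1 / a.ε⌉₊ + 1 := by
  have h : ((ratPair a.ε).2 / (ratPair a.ε).1 : ℕ) ≤ (⌈1 / a.ε⌉₊ : ℚ) := by
    refine Nat.cast_div_le.trans ?_
    rw [← one_div_eps]
    exact Nat.le_ceil _
  exact Nat.add_le_add_right (by exact_mod_cast h) 1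

@[fun_prop]
theorem polyTime_m {f : α → SchemeInput P K} (hf : PolyTime f) :
    PolyTime fun x => (f x).m := by
  have h : PolyTime fun a : SchemeInput P K => a.m :=
    (polyTime_eps.snd.div polyTime_eps.fst).add (.const 1)
  exact h.comp hf

theorem polyBdd_m : PolyBdd (m : SchemeInput P K → ℕ) :=
  (PolyBdd.mu.add (.const 1)).mono fun a => (m_le a).trans
    (Nat.add_le_add_right (Nat.le_add_left _ _) 1)

/-- The resolution of the rounded costs. -/
def r (a : SchemeInput P K) : ℕ := a.n * a.m

@[fun_prop]
theorem polyTime_r [NeZero K] {f : α → SchemeInput P K} (hf : PolyTime f) :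
    PolyTime fun x => (f x).r := by
  unfold r; fun_prop

theorem polyBdd_r [NeZero K] : PolyBdd (r : SchemeInput P K → ℕ) := polyBdd_n.mul polyBdd_m

/-! ### Integer versions of the costs, the weights and WOWA -/

/-- The product of the denominators of a list of fractions. -/
def commonDen (l : List (ℕ × ℕ)) : ℕ := (l.map Prod.snd).prod

@[fun_prop]
theorem polyTime_commonDen {f : α → List (ℕ × ℕ)} (hf : PolyTime f) :
    PolyTime fun x => commonDen (f x) := by
  unfold commonDen
  exact PolyTime.prod (PolyTime.map (g := fun _ q => q.2) (by fun_prop) hf)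

/-- The costs, multiplied by a common denominator. -/
def C (a : SchemeInput P K) (j i : ℕ) : ℕ :=
  ((a.costL.getD j []).getD i (0, 1)).1 *
    (commonDen a.costL.flatten / ((a.costL.getD j []).getD i (0, 1)).2)

@[fun_prop]
theorem polyTime_C {f : α → SchemeInput P K} {j i : α → ℕ} (hf : PolyTime f) (hj : PolyTime j)
    (hi : PolyTime i) : PolyTime fun x => (f x).C (j x) (i x) := by
  unfold C; fun_prop

/-- The probabilities, multiplied by a common denominator. -/
def Pr (a : SchemeInput P K) (i : ℕ) : ℕ :=
  (a.pL.getD i (0, 1)).1 * (commonDen a.pL / (a.pL.getD i (0, 1)).2)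

@[fun_prop]
theorem polyTime_Pr {f : α → SchemeInput P K} {i : α → ℕ} (hf : PolyTime f) (hi : PolyTime i) :
    PolyTime fun x => (f x).Pr (i x) := by
  unfold Pr; fun_prop

/-- The weights, multiplied by a common denominator. -/
def V (a : SchemeInput P K) (i : ℕ) : ℕ :=
  (a.vL.getD i (0, 1)).1 * (commonDen a.vL / (a.vL.getD i (0, 1)).2)

@[fun_prop]
theorem polyTime_V {f : α → SchemeInput P K} {i : α → ℕ} (hf : PolyTime f) (hi : PolyTime i) :
    PolyTime fun x => (f x).V (i x) := by
  unfold V; fun_prop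

/-- The function `w*`, multiplied by common denominators of the weights and probabilities. -/
def W (a : SchemeInput P K) (x : ℕ) : ℕ :=
  ∑ j ∈ Finset.range K, a.V j * min (commonDen a.pL) (K * x - j * commonDen a.pL)

@[fun_prop]
theorem polyTime_W {f : α → SchemeInput P K} {i : α → ℕ} (hf : PolyTime f) (hi : PolyTime i) :
    PolyTime fun x => (f x).W (i x) := by
  unfold W
  exact PolyTime.sum_range (f := fun x j => (f x).V j * min (commonDen (f x).pL)
    (K * i x - j * commonDen (f x).pL)) (PolyTime.const _) (by fun_prop)

/-- The scaled cost of a set that is given by a bit vector. -/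
def fval (a : SchemeInput P K) (S : List Bool) (j : ℕ) : ℕ :=
  ∑ i ∈ Finset.range a.n, if S.getD i false then a.C j i else 0

@[fun_prop]
theorem polyTime_fval [NeZero K] {f : α → SchemeInput P K} {S : α → List Bool} {j : α → ℕ}
    (hf : PolyTime f) (hS : PolyTime S) (hj : PolyTime j) :
    PolyTime fun x => (f x).fval (S x) (j x) := by
  unfold fval
  exact PolyTime.sum_range (f := fun x i => if (S x).getD i false then (f x).C (j x) i else 0)
    (by fun_prop) (by fun_prop)

/-- The probability of the scenarios up to a given one, in order of nonincreasing scaled cost. -/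
def upTo (a : SchemeInput P K) (S : List Bool) (j : ℕ) : ℕ :=
  ∑ i ∈ Finset.range K, if a.fval S j < a.fval S i ∨ a.fval S i = a.fval S j ∧ i ≤ j
    then a.Pr i else 0

/-- The probability of the scenarios before a given one, in order of nonincreasing scaled cost. -/
def before (a : SchemeInput P K) (S : List Bool) (j : ℕ) : ℕ :=
  ∑ i ∈ Finset.range K, if a.fval S j < a.fval S i ∨ a.fval S i = a.fval S j ∧ i < j
    then a.Pr i else 0

@[fun_prop]
theorem polyTime_upTo [NeZero K] {f : α → SchemeInput P K} {S : α → List Bool} {j : α → ℕ}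
    (hf : PolyTime f) (hS : PolyTime S) (hj : PolyTime j) :
    PolyTime fun x => (f x).upTo (S x) (j x) := by
  have h₁ : PolyTime fun p : α × ℕ => (f p.1).fval (S p.1) p.2 := by fun_prop
  have h₂ : PolyTime fun p : α × ℕ => (f p.1).fval (S p.1) (j p.1) := by fun_prop
  exact PolyTime.sum_range (PolyTime.const _) (PolyTime.ite
    (.decide_or (.decide_lt h₂ h₁) (.decide_and (.decide_eq h₁ h₂) (.decide_le .snd' (by fun_prop))))
    (by fun_prop) (.const 0))

@[fun_prop]
theorem polyTime_before [NeZero K] {f : α → SchemeInput P K} {S : α → List Bool} {j : α → ℕ}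
    (hf : PolyTime f) (hS : PolyTime S) (hj : PolyTime j) :
    PolyTime fun x => (f x).before (S x) (j x) := by
  have h₁ : PolyTime fun p : α × ℕ => (f p.1).fval (S p.1) p.2 := by fun_prop
  have h₂ : PolyTime fun p : α × ℕ => (f p.1).fval (S p.1) (j p.1) := by fun_prop
  exact PolyTime.sum_range (PolyTime.const _) (PolyTime.ite
    (.decide_or (.decide_lt h₂ h₁) (.decide_and (.decide_eq h₁ h₂) (.decide_lt .snd' (by fun_prop))))
    (by fun_prop) (.const 0))

/-- The scaled value of the set that is given by a bit vector. -/
def val (a : SchemeInput P K) (S : List Bool) : ℕ :=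
  ∑ j ∈ Finset.range K, (a.W (a.upTo S j) - a.W (a.before S j)) * a.fval S j

@[fun_prop]
theorem polyTime_val [NeZero K] {f : α → SchemeInput P K} {S : α → List Bool}
    (hf : PolyTime f) (hS : PolyTime S) : PolyTime fun x => (f x).val (S x) := by
  unfold val
  exact PolyTime.sum_range (f := fun x j => ((f x).W ((f x).upTo (S x) j) -
    (f x).W ((f x).before (S x) j)) * (f x).fval (S x) j) (PolyTime.const _) (by fun_prop)

/-! ### Rounded costs and queries to the exact problem -/

/-- The cost `c`, relative to the bound `b` and rounded down, if it does not exceed `b`. -/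
def rounded (a : SchemeInput P K) (b c : ℕ) : ℕ := if c ≤ b then c * a.r / b else a.n * a.r + 1

@[fun_prop]
theorem polyTime_rounded [NeZero K] {f : α → SchemeInput P K} {b c : α → ℕ}
    (hf : PolyTime f) (hb : PolyTime b) (hc : PolyTime c) :
    PolyTime fun x => (f x).rounded (b x) (c x) := by
  unfold rounded; fun_prop

/-- The bound does not involve `b` and `c`, which are given in binary and may be exponentially
large; this keeps the query costs polynomial in value. -/
theorem rounded_le (a : SchemeInput P K) (b c : ℕ) : a.rounded b c ≤ a.r + a.n * a.r + 1 := by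
  unfold rounded
  split_ifs with h
  · have : c * a.r / b ≤ a.r := Nat.div_le_of_le_mul (Nat.mul_le_mul_right _ h)
    omega
  · omega

/-- The costs of the query whether some solution that contains the set given by the bit vector `S`
has the rounded costs prescribed by `s`. -/
def queryCost (a : SchemeInput P K) (s : List (ℕ × ℕ)) (S : List Bool) (j i : ℕ) : ℕ :=
  a.rounded (s.getD j (0, 0)).1 (a.C j i) * (a.n + 1) + if S.getD i false then 1 else 0

/-- The number of elements of the set given by a bit vector. -/
def cardOf (a : SchemeInput P K) (S : List Bool) : ℕ :=
  ∑ i ∈ Finset.range a.n, if S.getD i false then 1 else 0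

theorem cardOf_le (a : SchemeInput P K) (S : List Bool) : a.cardOf S ≤ a.n := by
  refine (Finset.sum_le_card_nsmul _ _ 1 fun i _ => ?_).trans (by simp)
  split_ifs <;> simp

/-- The targets that go with `queryCost`. -/
def queryTarget (a : SchemeInput P K) (s : List (ℕ × ℕ)) (S : List Bool) (j : ℕ) : ℕ :=
  min (s.getD j (0, 0)).2 (a.n * a.r) * (a.n + 1) + a.cardOf S

/-- The query as an instance of the exact problem. -/
def query (x : SchemeInput P K × List (ℕ × ℕ) × List Bool) : ExactInstance P K where
  inst := x.1.J.inst
  cost j i := x.1.queryCost x.2.1 x.2.2 j i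
  target j := x.1.queryTarget x.2.1 x.2.2 j

/-- Since the measure of an exact instance includes its largest number, this contains the polynomial
bound on the values of costs and targets, not only on their lengths. -/
theorem polyTime_query [NeZero K] : PolyTime (query : _ → ExactInstance P K) := by
  have hcost : PolyTime fun y : ((SchemeInput P K × List (ℕ × ℕ) × List Bool) × ℕ) × ℕ =>
      y.1.1.1.queryCost y.1.1.2.1 y.1.1.2.2 y.1.2 y.2 := by
    unfold queryCost; fun_prop
  have htarget : PolyTime fun y : (SchemeInput P K × List (ℕ × ℕ) × List Bool) × ℕ =>
      y.1.1.queryTarget y.1.2.1 y.1.2.2 y.2 := by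
    unfold queryTarget
    refine .add (by fun_prop) ?_
    unfold cardOf
    exact PolyTime.sum_range
      (n := fun y : (SchemeInput P K × List (ℕ × ℕ) × List Bool) × ℕ => y.1.1.n)
      (f := fun y i => if y.1.2.2.getD i false then 1 else 0) (by fun_prop) (by fun_prop)
  have hL : PolyTime fun x : SchemeInput P K × List (ℕ × ℕ) × List Bool =>
      (x.1.bits, (List.range K).map fun j => (List.range x.1.n).map fun i =>
        x.1.queryCost x.2.1 x.2.2 j i,
        (List.range K).map fun j => x.1.queryTarget x.2.1 x.2.2 j) :=
    .prodMk (by fun_prop) (.prodMk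
      (.map (α := SchemeInput P K × List (ℕ × ℕ) × List Bool)
        (g := fun x j => (List.range x.1.n).map fun i => x.1.queryCost x.2.1 x.2.2 j i)
        (.map (α := (SchemeInput P K × List (ℕ × ℕ) × List Bool) × ℕ)
          (g := fun y i => y.1.1.queryCost y.1.2.1 y.1.2.2 y.2 i) hcost (by fun_prop))
        (.const _))
      (.map (α := SchemeInput P K × List (ℕ × ℕ) × List Bool)
        (g := fun x j => x.1.queryTarget x.2.1 x.2.2 j) htarget (.const _)))
  have henc : ∀ x : SchemeInput P K × List (ℕ × ℕ) × List Bool, enc (query x) =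
      enc (x.1.bits, (List.range K).map fun j => (List.range x.1.n).map fun i =>
        x.1.queryCost x.2.1 x.2.2 j i,
        (List.range K).map fun j => x.1.queryTarget x.2.1 x.2.2 j) := by
    intro x
    have e : enc (query x) = .pair (Data.ofBits x.1.bits)
      (.pair (Data.ofVec (Data.ofVec Data.nat) (query x).cost)
        (Data.ofVec Data.nat (query x).target)) := rfl
    rw [e, ofVec_eq_enc Data.nat (query x).target (query x).target fun _ => rfl,
      ofVec_eq_enc (Data.ofVec Data.nat) (query x).cost
        (fun j => List.ofFn fun i => (query x).cost j i) fun j =>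
          ofVec_eq_enc Data.nat _ _ fun _ => rfl]
    simp only [← ofFn_eq_map_range]
    rfl
  have hn : PolyBdd fun x : SchemeInput P K × List (ℕ × ℕ) × List Bool => x.1.n :=
    polyBdd_n.comp PolyTime.fst'.1
  have hr : PolyBdd fun x : SchemeInput P K × List (ℕ × ℕ) × List Bool => x.1.r :=
    polyBdd_r.comp PolyTime.fst'.1
  refine hL.congr_enc henc ?_
  refine (hL.1.add (((hr.add (hn.mul hr)).add (.const 1)).mul (hn.add (.const 1)) |>.add
    (hn.add (.const 1)))).mono fun x => ?_
  have h1 : ((exactProblem P K).encode (query x)).size ≤ mu (x.1.bits, (List.range K).map fun j =>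
      (List.range x.1.n).map fun i => x.1.queryCost x.2.1 x.2.2 j i,
        (List.range K).map fun j => x.1.queryTarget x.2.1 x.2.2 j) :=
    (congrArg Data.size (henc x)).trans_le (size_enc_le _)
  refine Nat.add_le_add h1 (max_le ?_ ?_)
  · refine Finset.sup_le fun j _ => Finset.sup_le fun i _ => ?_
    refine Nat.add_le_add (Nat.mul_le_mul_right _ (rounded_le _ _ _)) ?_
    split_ifs <;> simp
  -- The argument `s` is an arbitrary list of binary numbers; the minimum with `a.n * a.r` in
  -- `queryTarget` keeps the target small in value.
  · refine Finset.sup_le fun j _ => ?_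
    refine Nat.add_le_add (Nat.mul_le_mul_right _ ((min_le_right _ _).trans (by omega)))
      ((cardOf_le _ _).trans (Nat.le_succ _))

end SchemeInput
-- Minimization over a list and enumeration of choices
/-- The element of `d :: l` with the least value of `f`. -/
def argminD {β : Type} (f : β → ℕ) (d : β) (l : List β) : β :=
  l.foldl (fun b x => if f x < f b then x else b) d

theorem argminD_mem {β : Type} (f : β → ℕ) (l : List β) (d : β) : argminD f d l ∈ d :: l := by
  induction l generalizing d with
  | nil => simp [argminD]
  | cons x l ih =>
    have := ih (if f x < f d then x else d)
    simp only [argminD, List.foldl_cons] at this ⊢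
    split_ifs at this ⊢
    · exact List.mem_cons_of_mem _ this
    · rcases List.mem_cons.1 this with h | h
      · rw [h]; exact List.mem_cons_self
      · exact List.mem_cons_of_mem _ (List.mem_cons_of_mem _ h)

theorem argminD_le {β : Type} (f : β → ℕ) (l : List β) (d : β) :
    ∀ x ∈ d :: l, f (argminD f d l) ≤ f x := by
  induction l generalizing d with
  | nil => simp [argminD]
  | cons y l ih =>
    have h := ih (if f y < f d then y else d)
    have e : argminD f d (y :: l) = argminD f (if f y < f d then y else d) l := rfl
    rw [e]
    have h0 := h _ List.mem_cons_self
    intro x hx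
    rcases List.mem_cons.1 hx with rfl | hx
    · refine h0.trans ?_
      split_ifs with h' <;> omega
    · rcases List.mem_cons.1 hx with rfl | hx
      · refine h0.trans ?_
        split_ifs with h' <;> omega
      · exact h x (List.mem_cons_of_mem _ hx)

theorem PolyTime.argminD {α β : Type} [Enc α] [Enc β] {f : α → β → ℕ} {d : α → β} {l : α → List β}
    (hf : PolyTime fun p : α × β => f p.1 p.2) (hd : PolyTime d) (hl : PolyTime l) :
    PolyTime fun a => argminD (f a) (d a) (l a) := by
  have hfst : PolyTime fun p : α × β × β => f p.1 p.2.1 :=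
    hf.comp (f := fun p : α × β × β => (p.1, p.2.1)) (by fun_prop)
  have hsnd : PolyTime fun p : α × β × β => f p.1 p.2.2 :=
    hf.comp (f := fun p : α × β × β => (p.1, p.2.2)) (by fun_prop)
  refine foldl (g := fun a b x => if f a x < f a b then x else b) (fun a => mu (d a) + mu (l a)) hl
    hd (.ite (.decide_lt hsnd hfst) (by fun_prop) (by fun_prop)) (hd.1.add hl.1) fun a k => ?_
  rcases List.mem_cons.1 (argminD_mem (f a) ((l a).take k) (d a)) with h | h
  · exact (congrArg mu h).le.trans (Nat.le_add_right _ _)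
  · exact (mu_le_of_mem (List.mem_of_mem_take h)).trans (Nat.le_add_left _ _)

/-- All ways to choose one entry from each of the first `k` lists. -/
def choose {β : Type} : ℕ → List (List β) → List (List β)
  | 0, _ => [[]]
  | k + 1, L => (L.headD []).flatMap fun x => (choose k L.tail).map fun y => x :: y

/-- The induction on `k` builds one program for each `k`, with a time bound whose degree may depend
on `k`. This suffices because the number of scenarios is fixed. -/
theorem PolyTime.choose {α β : Type} [Enc α] [Enc β] (k : ℕ) {L : α → List (List β)}
    (hL : PolyTime L) : PolyTime fun a => choose k (L a) := by
  induction k generalizing α L with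
  | zero => exact .const _
  | succ k ih =>
    exact .flatMap (g := fun a x => (MinWowa.choose k (L a).tail).map fun y => x :: y)
      (.map (g := fun p y => p.2 :: y) (by fun_prop) (ih (L := fun p : α × β => (L p.1).tail)
        (by fun_prop))) (by fun_prop)

theorem mem_choose {β : Type} (k : ℕ) (L : ℕ → List β) (x : ℕ → β) (h : ∀ j < k, x j ∈ L j) :
    (List.range k).map x ∈ choose k ((List.range k).map L) := by
  induction k generalizing L x with
  | zero => simp [choose]
  | succ k ih =>
    have := ih (fun j => L (j + 1)) (fun j => x (j + 1)) fun j hj => h (j + 1) (by omega)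
    simp only [List.range_succ_eq_map, choose, List.map_cons, List.map_map, List.headD_cons,
      List.tail_cons, List.mem_flatMap, List.mem_map]
    exact ⟨x 0, h 0 (by omega), _, this, rfl⟩

/-! ### The approximation algorithm -/

namespace SchemeInput

variable {P : DiscreteProblem} {K : ℕ} {α : Type} [Enc α]

open Classical in
/-- The answer to a query. -/
noncomputable def ask (x : SchemeInput P K × List (ℕ × ℕ) × List Bool) : Bool :=
  decide ((exactProblem P K).Holds (query x))

theorem polyTime_ask [NeZero K] (hexact : (exactProblem P K).SolvableInPseudopolynomialTime) :
    PolyTime (ask : SchemeInput P K × List (ℕ × ℕ) × List Bool → Bool) := by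
  classical
  obtain ⟨c, q, h⟩ := hexact
  -- By the choice of the measure on exact instances this is the hypothesis itself.
  have : PolyTime fun J : ExactInstance P K => decide ((exactProblem P K).Holds J) :=
    ⟨PolyBdd.const 2, c, _, ⟨q, fun _ => le_rfl⟩, fun J => h J⟩
  exact this.comp polyTime_query

/-- Extract a solution with the rounded costs prescribed by `s`, element by element. -/
noncomputable def greedy (a : SchemeInput P K) (s : List (ℕ × ℕ)) : List Bool :=
  (List.range a.n).foldl (fun S _ => S ++ [ask (a, s, S ++ [true])]) []

theorem polyTime_greedy [NeZero K]
    (hexact : (exactProblem P K).SolvableInPseudopolynomialTime) :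
    PolyTime fun x : SchemeInput P K × List (ℕ × ℕ) => x.1.greedy x.2 := by
  have hask := polyTime_ask hexact
  -- Each round appends one bit, whatever the answer, and adds exactly `3` to the measure.
  have hlen : ∀ (x : SchemeInput P K × List (ℕ × ℕ)) (l : List ℕ) (S : List Bool),
      mu (l.foldl (fun S _ => S ++ [ask (x.1, x.2, S ++ [true])]) S) = mu S + 3 * l.length := by
    intro x l
    induction l with
    | nil => simp
    | cons y l ih =>
      intro S
      have := mu_append S [ask (x.1, x.2, S ++ [true])]
      rw [List.foldl_cons, ih, List.length_cons]
      simp only [mu_cons, mu_bool, mu_nil] at this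
      omega
  refine .foldl (l := fun x : SchemeInput P K × List (ℕ × ℕ) => List.range x.1.n)
    (i := fun _ => []) (g := fun x S _ => S ++ [ask (x.1, x.2, S ++ [true])])
    (fun x => 1 + 3 * x.1.n) (by fun_prop) (.const _) ?_
    ((PolyBdd.const 1).add ((PolyBdd.const 3).mul (polyBdd_n.comp PolyTime.fst'.1))) ?_
  · refine .append (by fun_prop) (.cons (hask.comp (f := fun p :
      (SchemeInput P K × List (ℕ × ℕ)) × List Bool × ℕ =>
        (p.1.1, p.1.2, p.2.1 ++ [true])) (by fun_prop)) (.const _))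
  · intro x k
    rw [hlen]
    simp only [mu_nil, List.length_take, List.length_range]
    have := min_le_right k x.1.n
    omega

/-- The bounds on the costs of single elements and the rounded costs to try for one scenario. -/
def options (a : SchemeInput P K) (j : ℕ) : List (ℕ × ℕ) :=
  (0 :: (List.range a.n).map fun i => a.C j i).flatMap fun b =>
    (List.range (a.n * a.r + 1)).map fun t => (b, t)

/-- The bounds and rounded costs to try for all scenarios. -/
def choices (a : SchemeInput P K) : List (List (ℕ × ℕ)) :=
  choose K ((List.range K).map fun j => a.options j)

theorem polyTime_choices [NeZero K] : PolyTime fun a : SchemeInput P K => a.choices := by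
  have hr : PolyTime fun a : SchemeInput P K => List.range (a.n * a.r + 1) :=
    .range (by fun_prop) ((polyBdd_n.mul polyBdd_r).add (.const 1))
  refine .choose K (.map (α := SchemeInput P K) (g := fun a j => a.options j) ?_ (.const _))
  exact .flatMap (α := SchemeInput P K × ℕ)
    (g := fun x b => (List.range (x.1.n * x.1.r + 1)).map fun t => (b, t))
    (.map (α := (SchemeInput P K × ℕ) × ℕ) (g := fun p t => (p.2, t)) (by fun_prop)
      (hr.comp (f := fun p : (SchemeInput P K × ℕ) × ℕ => p.1.1) (by fun_prop))) (by fun_prop)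

/-- The bit vectors of the candidate solutions. -/
noncomputable def candidates (a : SchemeInput P K) : List (List Bool) :=
  (a.choices.filter fun s => ask (a, s, [])).map fun s => a.greedy s

theorem polyTime_candidates [NeZero K]
    (hexact : (exactProblem P K).SolvableInPseudopolynomialTime) :
    PolyTime fun a : SchemeInput P K => a.candidates :=
  .map (α := SchemeInput P K) (g := fun a s => a.greedy s) (polyTime_greedy hexact)
    (.filter (α := SchemeInput P K) (p := fun a s => ask (a, s, [])) ((polyTime_ask hexact).comp
      (f := fun x : SchemeInput P K × List (ℕ × ℕ) => (x.1, x.2, [])) (by fun_prop))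
      polyTime_choices)

/-- The bit vector of a best candidate solution. -/
noncomputable def best (a : SchemeInput P K) : Option (List Bool) :=
  if a.candidates.isEmpty then none else
    some (argminD (fun S => a.val S) (a.candidates.headD []) a.candidates)

theorem polyTime_best [NeZero K]
    (hexact : (exactProblem P K).SolvableInPseudopolynomialTime) :
    PolyTime fun a : SchemeInput P K => a.best := by
  have h := polyTime_candidates hexact
  exact .ite (.decide_bool h.isEmpty) (.const _)
    (.some (.argminD (α := SchemeInput P K) (f := fun a S => a.val S) (by fun_prop) (h.headD (.const _)) h))

end SchemeInput

/-! ### Homogeneity and monotonicity of WOWA -/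

section Wowa
variable {K : ℕ}

theorem wStar_mono {v : Fin K → ℚ} (hv : ∀ j, 0 ≤ v j) : Monotone (wStar v) := by
  intro x y h
  unfold wStar
  gcongr with j _
  exact hv j

theorem wStar_zero (v : Fin K → ℚ) : wStar v 0 = 0 := by
  unfold wStar
  refine Finset.sum_eq_zero fun j _ => ?_
  rw [max_eq_left ((min_le_right _ _).trans (by simp)), mul_zero]

/-- `Tuple.sort` is stable, so ties are ordered by index. This allows positions in the sorted order
to be described without the permutation. -/
theorem sortDesc_lt {a : Fin K → ℚ} {i j : Fin K} (h : i < j) :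
    a (sortDesc a j) < a (sortDesc a i) ∨
      a (sortDesc a i) = a (sortDesc a j) ∧ sortDesc a i < sortDesc a j := by
  rcases (sortDesc_antitone a h.le).lt_or_eq with h' | h'
  · exact .inl h'
  · exact .inr ⟨h'.symm, (Tuple.eq_sort_iff.1 (rfl : sortDesc a = Tuple.sort _)).2 i j h
      (by simpa using h'.symm)⟩

theorem sortDesc_lt_iff {a : Fin K → ℚ} {i j : Fin K} :
    (a (sortDesc a j) < a (sortDesc a i) ∨
      a (sortDesc a i) = a (sortDesc a j) ∧ sortDesc a i < sortDesc a j) ↔ i < j := by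
  refine ⟨fun h => ?_, sortDesc_lt⟩
  rcases lt_trichotomy i j with h' | rfl | h'
  · exact h'
  · simp at h
  · rcases h with h | ⟨h, h1⟩ <;> rcases sortDesc_lt h' with h2 | ⟨h2, h3⟩
    · exact absurd h h2.not_gt
    · exact absurd h2 h.ne
    · exact absurd h h2.ne
    · exact absurd h1 h3.not_gt

theorem sortDesc_le_iff {a : Fin K → ℚ} {i j : Fin K} :
    (a (sortDesc a j) < a (sortDesc a i) ∨
      a (sortDesc a i) = a (sortDesc a j) ∧ sortDesc a i ≤ sortDesc a j) ↔ i ≤ j := by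
  rw [le_iff_lt_or_eq (a := i), ← sortDesc_lt_iff (a := a) (i := i) (j := j),
    le_iff_lt_or_eq (a := sortDesc a i), and_or_left, ← or_assoc]
  refine or_congr Iff.rfl ⟨fun h => (sortDesc a).injective h.2, ?_⟩
  rintro rfl
  exact ⟨rfl, rfl⟩

/-- The operator without sorting: each entry is weighted according to the probability of the
entries that precede it. -/
theorem wowa_eq_sum (v p a : Fin K → ℚ) : wowa v p a = ∑ j,
    (wStar v (∑ i, if a j < a i ∨ a i = a j ∧ i ≤ j then p i else 0) -
      wStar v (∑ i, if a j < a i ∨ a i = a j ∧ i < j then p i else 0)) * a j := by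
  rw [← Equiv.sum_comp (sortDesc a)]
  refine Finset.sum_congr rfl fun j _ => ?_
  rw [← Equiv.sum_comp (sortDesc a) fun i => if a (sortDesc a j) < a i ∨
      a i = a (sortDesc a j) ∧ i ≤ sortDesc a j then p i else 0,
    ← Equiv.sum_comp (sortDesc a) fun i => if a (sortDesc a j) < a i ∨
      a i = a (sortDesc a j) ∧ i < sortDesc a j then p i else 0]
  simp only [sortDesc_lt_iff, sortDesc_le_iff, ← Finset.sum_filter]
  congr <;> ext <;> simp

/-- In the formula without sorting the weights depend only on comparisons between entries, which a
positive factor preserves. -/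
theorem wowa_smul (v p a : Fin K → ℚ) {N : ℚ} (hN : 0 < N) :
    wowa v p (fun j => N * a j) = N * wowa v p a := by
  rw [wowa_eq_sum, wowa_eq_sum, Finset.mul_sum]
  refine Finset.sum_congr rfl fun j _ => ?_
  simp only [mul_lt_mul_iff_right₀ hN, mul_right_inj' hN.ne']
  ring

/-- A down-closed set with maximum `m` is `Finset.Iic m`, and removing `m` leaves `Finset.Iio m`, so
the last term is the increment of `w` at this step. -/
theorem sum_telescope (w : ℚ → ℚ) (hw : w 0 = 0) (q : Fin K → ℚ) (s : Finset (Fin K))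
    (hs : ∀ i j, i ≤ j → j ∈ s → i ∈ s) :
    ∑ j ∈ s, (w (∑ i ∈ Finset.Iic j, q i) - w (∑ i ∈ Finset.Iio j, q i)) = w (∑ i ∈ s, q i) := by
  induction s using Finset.induction_on_max with
  | empty => simp [hw]
  | insert m s hlt ih =>
    have h1 : s = Finset.Iio m := by
      ext i
      rw [Finset.mem_Iio]
      refine ⟨hlt i, fun h => ?_⟩
      rcases Finset.mem_insert.1 (hs i m h.le (Finset.mem_insert_self _ _)) with rfl | h'
      · exact absurd h (lt_irrefl _)
      · exact h'
    have h2 : insert m s = Finset.Iic m := by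
      ext i
      rw [Finset.mem_insert, h1, Finset.mem_Iio, Finset.mem_Iic, le_iff_eq_or_lt]
    rw [Finset.sum_insert fun h => lt_irrefl _ (hlt m h), ih, h2, h1, sub_add_cancel]
    intro i j hij hj
    rw [h1, Finset.mem_Iio] at hj ⊢
    exact hij.trans_lt hj

/-- The layer-cake formula for integer vectors. -/
theorem wowa_natCast (v p : Fin K → ℚ) (a : Fin K → ℕ) {M : ℕ} (hM : ∀ j, a j ≤ M) :
    wowa v p (fun j => (a j : ℚ)) =
      ∑ t ∈ Finset.range M, wStar v (∑ j with t < a j, p j) := by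
  set b : Fin K → ℚ := fun j => (a j : ℚ) with hb
  have h1 : ∀ j, b j = ∑ t ∈ Finset.range M, if t < a j then 1 else 0 := by
    intro j
    have : (Finset.range M).filter (· < a j) = Finset.range (a j) := by
      ext t
      have := hM j
      simp only [Finset.mem_filter, Finset.mem_range]; omega
    rw [← Finset.sum_filter, this]
    simp [hb]
  unfold wowa
  have h2 : ∀ j, (wStar v (∑ i ∈ Finset.Iic j, p (sortDesc b i)) -
      wStar v (∑ i ∈ Finset.Iio j, p (sortDesc b i))) * b (sortDesc b j) =
      ∑ t ∈ Finset.range M, if t < a (sortDesc b j) then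
        wStar v (∑ i ∈ Finset.Iic j, p (sortDesc b i)) -
          wStar v (∑ i ∈ Finset.Iio j, p (sortDesc b i)) else 0 := by
    intro j
    rw [h1, Finset.mul_sum]
    simp
  simp only [h2]
  rw [Finset.sum_comm]
  refine Finset.sum_congr rfl fun t _ => ?_
  -- In sorted order the entries above `t` form an initial segment, so their weights telescope to
  -- `w*` of their total probability.
  rw [← Finset.sum_filter, sum_telescope (wStar v) (wStar_zero v) fun i => p (sortDesc b i)]
  · rw [Finset.sum_filter, Finset.sum_filter,
      Equiv.sum_comp (sortDesc b) fun i => if t < a i then p i else 0]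
  · intro i j hij hj
    simp only [Finset.mem_filter, Finset.mem_univ, true_and] at hj ⊢
    have : b (sortDesc b j) ≤ b (sortDesc b i) := sortDesc_antitone b hij
    have : a (sortDesc b j) ≤ a (sortDesc b i) := by simpa [hb] using this
    omega

theorem exists_nat_of_den_dvd {q : ℚ} (hq : 0 ≤ q) {N : ℕ} (h : q.den ∣ N) :
    (N : ℚ) * q = ((q.num.natAbs * (N / q.den) : ℕ) : ℚ) := by
  obtain ⟨k, rfl⟩ := h
  have h1 : (q.num.natAbs : ℚ) = q.num := by
    rw [← Int.cast_natCast, Int.natAbs_of_nonneg (Rat.num_nonneg.2 hq)]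
  rw [Nat.mul_div_cancel_left _ q.den_pos]
  push_cast
  rw [h1, ← Rat.mul_den_eq_num q]
  ring

/-- The two vectors may be sorted differently, so weights cannot be compared term by term. After
scaling both to natural numbers, the layer-cake formula compares layers instead: superlevel sets
only grow, and so does `w*` of their probability. -/
theorem wowa_mono {v p a b : Fin K → ℚ} (hv : ∀ j, 0 ≤ v j) (hp : ∀ j, 0 ≤ p j)
    (ha : ∀ j, 0 ≤ a j) (hab : ∀ j, a j ≤ b j) : wowa v p a ≤ wowa v p b := by
  obtain ⟨N, hN⟩ : ∃ N : ℕ, N = ∏ j, (a j).den * (b j).den := ⟨_, rfl⟩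
  have hN0 : (0 : ℚ) < N := by
    have : 0 < N := hN ▸ Finset.prod_pos fun j _ => Nat.mul_pos (a j).den_pos (b j).den_pos
    exact_mod_cast this
  have hd : ∀ j, (a j).den * (b j).den ∣ N := fun j =>
    hN ▸ Finset.dvd_prod_of_mem (fun j => (a j).den * (b j).den) (Finset.mem_univ j)
  have h1 := fun j => exists_nat_of_den_dvd (ha j) ((dvd_mul_right _ _).trans (hd j))
  have h2 := fun j => exists_nat_of_den_dvd ((ha j).trans (hab j)) ((dvd_mul_left _ _).trans (hd j))
  rw [← mul_le_mul_iff_right₀ hN0, ← wowa_smul _ _ _ hN0, ← wowa_smul _ _ _ hN0]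
  have hle : ∀ j, (N : ℚ) * a j ≤ N * b j := fun j => mul_le_mul_of_nonneg_left (hab j) hN0.le
  simp only [h1, h2] at hle ⊢
  set x : Fin K → ℕ := fun j => (a j).num.natAbs * (N / (a j).den)
  set y : Fin K → ℕ := fun j => (b j).num.natAbs * (N / (b j).den)
  have hxy : ∀ j, x j ≤ y j := fun j => by exact_mod_cast hle j
  have hM : ∀ j, y j ≤ Finset.univ.sup y := fun j => Finset.le_sup (Finset.mem_univ j)
  rw [wowa_natCast v p x fun j => (hxy j).trans (hM j), wowa_natCast v p y hM]
  refine Finset.sum_le_sum fun t _ => wStar_mono hv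
    (Finset.sum_le_sum_of_subset_of_nonneg (fun j hj => ?_) fun j _ _ => hp j)
  simp only [Finset.mem_filter, Finset.mem_univ, true_and] at hj ⊢
  exact hj.trans_le (hxy j)

end Wowa

/-! ### Correctness of the integer scaling -/

namespace SchemeInput

variable {P : DiscreteProblem} {K : ℕ}

theorem commonDen_pos {l : List (ℕ × ℕ)} (h : ∀ x ∈ l, 0 < x.2) : 0 < commonDen l := by
  refine List.prod_pos fun x hx => ?_
  obtain ⟨y, hy, rfl⟩ := List.mem_map.1 hx
  exact h y hy

theorem dvd_commonDen {l : List (ℕ × ℕ)} {x : ℕ × ℕ} (h : x ∈ l) : x.2 ∣ commonDen l :=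
  List.dvd_prod (List.mem_map_of_mem h)

theorem getD_ofFn {β : Type} {k : ℕ} (f : Fin k → β) (d : β) (i : Fin k) :
    (List.ofFn f).getD i d = f i := by
  simp [List.getD_eq_getElem?_getD]

/-- The common denominator of the costs. -/
def costDen (a : SchemeInput P K) : ℕ := commonDen a.costL.flatten

theorem costDen_pos (a : SchemeInput P K) : 0 < a.costDen := by
  refine commonDen_pos fun x hx => ?_
  obtain ⟨l, hl, hx⟩ := List.mem_flatten.1 hx
  obtain ⟨j, rfl⟩ := List.mem_ofFn.1 hl
  obtain ⟨i, rfl⟩ := List.mem_ofFn.1 hx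
  exact Rat.den_pos _

theorem pDen_pos (a : SchemeInput P K) : 0 < commonDen a.pL := by
  refine commonDen_pos fun x hx => ?_
  obtain ⟨j, rfl⟩ := List.mem_ofFn.1 hx
  exact Rat.den_pos _

theorem vDen_pos (a : SchemeInput P K) : 0 < commonDen a.vL := by
  refine commonDen_pos fun x hx => ?_
  obtain ⟨j, rfl⟩ := List.mem_ofFn.1 hx
  exact Rat.den_pos _

theorem cast_C (a : SchemeInput P K) (j : Fin K) (i : Fin a.n) :
    (a.C j i : ℚ) = a.costDen * a.J.cost j i := by
  have h : (a.costL.getD j []).getD i (0, 1) = ratPair (a.J.cost j i) := by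
    rw [costL, getD_ofFn]
    exact getD_ofFn _ _ i
  have hmem : ratPair (a.J.cost j i) ∈ a.costL.flatten :=
    List.mem_flatten.2 ⟨_, List.mem_ofFn.2 ⟨j, rfl⟩, List.mem_ofFn.2 ⟨i, rfl⟩⟩
  rw [costDen, exists_nat_of_den_dvd (a.J.cost_nonneg j i) (dvd_commonDen hmem), C, h]
  rfl

theorem cast_Pr (a : SchemeInput P K) (j : Fin K) :
    (a.Pr j : ℚ) = commonDen a.pL * a.J.p j := by
  have h : a.pL.getD j (0, 1) = ratPair (a.J.p j) := getD_ofFn _ _ j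
  have hmem : ratPair (a.J.p j) ∈ a.pL := List.mem_ofFn.2 ⟨j, rfl⟩
  rw [exists_nat_of_den_dvd (a.J.p_nonneg j) (dvd_commonDen hmem), Pr, h]
  rfl

theorem cast_V (a : SchemeInput P K) (j : Fin K) :
    (a.V j : ℚ) = commonDen a.vL * a.J.v j := by
  have h : a.vL.getD j (0, 1) = ratPair (a.J.v j) := getD_ofFn _ _ j
  have hmem : ratPair (a.J.v j) ∈ a.vL := List.mem_ofFn.2 ⟨j, rfl⟩
  rw [exists_nat_of_den_dvd (a.J.v_nonneg j) (dvd_commonDen hmem), V, h]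
  rfl

theorem cast_W (a : SchemeInput P K) {x : ℕ} {y : ℚ} (h : (x : ℚ) = commonDen a.pL * y) :
    (a.W x : ℚ) = commonDen a.vL * commonDen a.pL * wStar a.J.v y := by
  rw [W, Finset.sum_range, wStar, Finset.mul_sum, Nat.cast_sum]
  refine Finset.sum_congr rfl fun j _ => ?_
  have hD : (0 : ℚ) ≤ commonDen a.pL := Nat.cast_nonneg _
  -- Truncated subtraction plays the role of `max 0` in `wStar`, and the cap `commonDen a.pL` in `W`
  -- that of `min 1`.
  have h1 : ((K * x - j * commonDen a.pL : ℕ) : ℚ) =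
      commonDen a.pL * max 0 (K * y - (j : ℕ)) := by
    rw [mul_max_of_nonneg _ _ hD, mul_zero, mul_sub]
    rcases le_total (j * commonDen a.pL) (K * x) with h' | h'
    · have h'' : ((j : ℕ) : ℚ) * commonDen a.pL ≤ K * x := by exact_mod_cast h'
      rw [h] at h''
      rw [max_eq_right (by linarith)]
      push_cast [h', h]
      ring
    · have h'' : (K : ℚ) * x ≤ (j : ℕ) * commonDen a.pL := by exact_mod_cast h'
      rw [h] at h''
      rw [max_eq_left (by linarith), Nat.sub_eq_zero_of_le h', Nat.cast_zero]
  rw [Nat.cast_mul, Nat.cast_min, h1, cast_V, max_min_distrib_left, max_eq_right zero_le_one,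
    mul_assoc, mul_assoc, mul_left_comm (commonDen a.pL : ℚ), mul_min_of_nonneg _ _ hD, mul_one]

/-- The set given by a bit vector. -/
def toSet (a : SchemeInput P K) (S : List Bool) : Finset (Fin a.n) :=
  Finset.univ.filter fun i => S.getD i false

theorem mem_toSet {a : SchemeInput P K} {S : List Bool} {i : Fin a.n} :
    i ∈ a.toSet S ↔ S.getD i false = true := by
  simp [toSet]

theorem cast_fval (a : SchemeInput P K) (S : List Bool) (j : Fin K) :
    (a.fval S j : ℚ) = a.costDen * solutionCost (a.toSet S) (a.J.cost j) := by
  rw [fval, Finset.sum_range, ← Finset.sum_filter, Nat.cast_sum]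
  exact (Finset.sum_congr rfl fun i _ => a.cast_C j i).trans (Finset.mul_sum _ _ _).symm

theorem W_mono (a : SchemeInput P K) : Monotone a.W := by
  intro x y h
  unfold W
  gcongr

theorem before_le_upTo (a : SchemeInput P K) (S : List Bool) (j : ℕ) :
    a.before S j ≤ a.upTo S j := by
  refine Finset.sum_le_sum fun i _ => ?_
  split_ifs with h h'
  · exact le_rfl
  · exact absurd (h.imp_right fun h => ⟨h.1, h.2.le⟩) h'
  · exact Nat.zero_le _
  · exact le_rfl

/-- A positive common denominator changes neither the order of the scenario costs nor the ties, so
the weights are attached to the same scenarios. -/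
theorem cast_val (a : SchemeInput P K) (S : List Bool) :
    (a.val S : ℚ) = commonDen a.vL * commonDen a.pL * a.costDen *
      wowa a.J.v a.J.p fun j => solutionCost (a.toSet S) (a.J.cost j) := by
  have hD : (0 : ℚ) < a.costDen := Nat.cast_pos.2 a.costDen_pos
  have hlt : ∀ i j : Fin K, a.fval S i < a.fval S j ↔
      solutionCost (a.toSet S) (a.J.cost i) < solutionCost (a.toSet S) (a.J.cost j) := by
    intro i j
    rw [← Nat.cast_lt (α := ℚ), cast_fval, cast_fval, mul_lt_mul_iff_right₀ hD]
  have heq : ∀ i j : Fin K, a.fval S i = a.fval S j ↔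
      solutionCost (a.toSet S) (a.J.cost i) = solutionCost (a.toSet S) (a.J.cost j) := by
    intro i j
    rw [← Nat.cast_inj (R := ℚ), cast_fval, cast_fval, mul_right_inj' hD.ne']
  rw [wowa_eq_sum, val, Finset.sum_range, Nat.cast_sum, Finset.mul_sum]
  refine Finset.sum_congr rfl fun j _ => ?_
  have hU : (a.upTo S j : ℚ) = commonDen a.pL * ∑ i, if
      solutionCost (a.toSet S) (a.J.cost j) < solutionCost (a.toSet S) (a.J.cost i) ∨
        solutionCost (a.toSet S) (a.J.cost i) = solutionCost (a.toSet S) (a.J.cost j) ∧ i ≤ j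
      then a.J.p i else 0 := by
    rw [upTo, Finset.sum_range, Nat.cast_sum, Finset.mul_sum]
    refine Finset.sum_congr rfl fun i _ => ?_
    simp only [hlt, heq, Fin.val_fin_le]
    split_ifs
    · exact a.cast_Pr i
    · simp
  have hB : (a.before S j : ℚ) = commonDen a.pL * ∑ i, if
      solutionCost (a.toSet S) (a.J.cost j) < solutionCost (a.toSet S) (a.J.cost i) ∨
        solutionCost (a.toSet S) (a.J.cost i) = solutionCost (a.toSet S) (a.J.cost j) ∧ i < j
      then a.J.p i else 0 := by
    rw [before, Finset.sum_range, Nat.cast_sum, Finset.mul_sum]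
    refine Finset.sum_congr rfl fun i _ => ?_
    simp only [hlt, heq, Fin.val_fin_lt]
    split_ifs
    · exact a.cast_Pr i
    · simp
  -- The subtraction in `val` is truncated; it is exact because `W` is monotone.
  rw [Nat.cast_mul, Nat.cast_sub (a.W_mono (a.before_le_upTo S j)), cast_fval, a.cast_W hU,
    a.cast_W hB]
  ring

theorem value_le_of_val_le (a : SchemeInput P K) {S T : List Bool} (h : a.val S ≤ a.val T) :
    (minWowa P K).value a.J (a.toSet S) ≤ (minWowa P K).value a.J (a.toSet T) := by
  have h' : (a.val S : ℚ) ≤ a.val T := by exact_mod_cast h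
  rw [cast_val, cast_val] at h'
  refine le_of_mul_le_mul_left h' ?_
  have h1 := a.costDen_pos
  have h2 := a.pDen_pos
  have h3 := a.vDen_pos
  positivity

/-! ### Correctness of queries and of the greedy extraction -/

/-- A set has the rounded costs that are prescribed by `s`. -/
def HasRounded (a : SchemeInput P K) (s : List (ℕ × ℕ)) (X : Finset (Fin a.n)) : Prop :=
  ∀ j : Fin K, ∑ i ∈ X, a.rounded (s.getD j (0, 0)).1 (a.C j i) =
    min (s.getD j (0, 0)).2 (a.n * a.r)

theorem cardOf_eq (a : SchemeInput P K) (S : List Bool) : a.cardOf S = (a.toSet S).card := by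
  rw [cardOf, Finset.sum_range, toSet, Finset.card_filter]

theorem queryCost_sum (a : SchemeInput P K) (s : List (ℕ × ℕ)) (S : List Bool)
    (X : Finset (Fin a.n)) (j : Fin K) : ∑ i ∈ X, a.queryCost s S j i =
      (∑ i ∈ X, a.rounded (s.getD j (0, 0)).1 (a.C j i)) * (a.n + 1) +
        (X ∩ a.toSet S).card := by
  simp only [queryCost]
  rw [Finset.sum_add_distrib, ← Finset.sum_mul, ← Finset.card_filter]
  congr 2
  ext i
  simp [mem_toSet]

/-- In base `a.n + 1` the last digit of the query cost of `X` is the size of `X ∩ a.toSet S`; it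
equals the size of `a.toSet S` exactly when `X` contains that set. -/
theorem ask_iff [NeZero K] (a : SchemeInput P K) (s : List (ℕ × ℕ)) (S : List Bool) :
    ask (a, s, S) = true ↔ ∃ X ∈ P.feasible a.J.inst, a.HasRounded s X ∧ a.toSet S ⊆ X := by
  have hX : ∀ X : Finset (Fin a.n), (∀ j : Fin K, ∑ i ∈ X, a.queryCost s S j i =
      a.queryTarget s S j) ↔ a.HasRounded s X ∧ a.toSet S ⊆ X := by
    intro X
    have hcard : ∀ Z : Finset (Fin a.n), Z.card < a.n + 1 := fun Z =>
      Nat.lt_succ_of_le ((Finset.card_le_univ Z).trans (by simp))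
    -- Uniqueness of quotient and remainder; no carry occurs because a set of elements has at most
    -- `a.n` members.
    have key : ∀ u v x y : ℕ, x < a.n + 1 → y < a.n + 1 →
        (u * (a.n + 1) + x = v * (a.n + 1) + y ↔ u = v ∧ x = y) := by
      intro u v x y hx hy
      refine ⟨fun h => ?_, by rintro ⟨rfl, rfl⟩; rfl⟩
      have h1 := congrArg (· / (a.n + 1)) h
      have h2 := congrArg (· % (a.n + 1)) h
      simp only [Nat.mul_add_mod', Nat.mod_eq_of_lt hx, Nat.mod_eq_of_lt hy] at h2
      refine ⟨?_, h2⟩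
      rw [h2] at h
      exact Nat.eq_of_mul_eq_mul_right (Nat.succ_pos _) (Nat.add_right_cancel h)
    simp only [queryCost_sum, queryTarget, cardOf_eq, key _ _ _ _ (hcard _) (hcard _)]
    have hsub : (X ∩ a.toSet S).card = (a.toSet S).card ↔ a.toSet S ⊆ X := by
      refine ⟨fun h => ?_, fun h => by rw [Finset.inter_eq_right.2 h]⟩
      exact Finset.inter_eq_right.1 (Finset.eq_of_subset_of_card_le Finset.inter_subset_right h.ge)
    rw [forall_and, hsub]
    -- The containment condition is the same in every scenario; scenario `0` is available since `K ≠
    -- 0`.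
    exact and_congr_right fun _ => ⟨fun h => h ⟨0, Nat.pos_of_ne_zero (NeZero.ne K)⟩,
      fun h _ => h⟩
  refine (@decide_eq_true_iff _ (Classical.propDecidable _)).trans ?_
  exact exists_congr fun X => and_congr_right fun _ => hX X

theorem getD_append_singleton (S : List Bool) (b : Bool) (i : ℕ) :
    (S ++ [b]).getD i false = if i = S.length then b else S.getD i false := by
  simp only [List.getD_eq_getElem?_getD]
  rcases lt_trichotomy i S.length with h | rfl | h
  · rw [List.getElem?_append_left h, if_neg h.ne]
  · simp
  · rw [if_neg h.ne', List.getElem?_eq_none (by simp; omega), List.getElem?_eq_none h.le]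

/-- Exclusions need not be part of a query: an element rejected once lies in no suitable solution
containing the current set, and enlarging that set only leaves fewer solutions. -/
theorem greedy_spec [NeZero K] (a : SchemeInput P K) {s : List (ℕ × ℕ)}
    (h : ask (a, s, []) = true) : (a.greedy s).length = a.n ∧
      a.toSet (a.greedy s) ∈ P.feasible a.J.inst ∧ a.HasRounded s (a.toSet (a.greedy s)) := by
  let G : ℕ → List Bool := fun k =>
    (List.range k).foldl (fun S _ => S ++ [ask (a, s, S ++ [true])]) []
  have hG : ∀ k, G (k + 1) = G k ++ [ask (a, s, G k ++ [true])] := by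
    intro k
    simp only [G, List.range_succ, List.foldl_append, List.foldl_cons, List.foldl_nil]
  have hlen : ∀ k, (G k).length = k := by
    intro k
    induction k with
    | zero => simp [G]
    | succ k ih => simp [hG, ih]
  -- Some suitable solution contains the current set, and every such solution agrees with it on the
  -- first `k` elements. At `k = a.n` the set is itself the solution.
  have hinv : ∀ k, ask (a, s, G k) = true ∧ ∀ X ∈ P.feasible a.J.inst, a.HasRounded s X →
      a.toSet (G k) ⊆ X → ∀ i : Fin a.n, (i : ℕ) < k → i ∈ X → i ∈ a.toSet (G k) := by
    intro k
    induction k with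
    | zero => exact ⟨h, fun X _ _ _ i hi => absurd hi (Nat.not_lt_zero _)⟩
    | succ k ih =>
      have hmem : ∀ (b : Bool) (i : Fin a.n), i ∈ a.toSet (G k ++ [b]) ↔
          if (i : ℕ) = k then b = true else i ∈ a.toSet (G k) := by
        intro b i
        rw [mem_toSet, getD_append_singleton, hlen, mem_toSet]
        split_ifs <;> rfl
      have hnot : ∀ i : Fin a.n, (i : ℕ) = k → i ∉ a.toSet (G k) := by
        intro i hi
        rw [mem_toSet, List.getD_eq_getElem?_getD, List.getElem?_eq_none (by rw [hlen]; exact hi.ge)]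
        simp
      rw [hG]
      rcases hb : ask (a, s, G k ++ [true]) with _ | _
      · have e : a.toSet (G k ++ [false]) = a.toSet (G k) := by
          ext i
          rw [hmem]
          split_ifs with hi
          · simp [hnot i hi]
          · rfl
        constructor
        · rw [ask_iff, e, ← ask_iff]; exact ih.1
        · intro X hX hs hsub i hi hiX
          rw [e] at hsub ⊢
          rcases Nat.lt_succ_iff_lt_or_eq.1 hi with hi | hi
          · exact ih.2 X hX hs hsub i hi hiX
          · exfalso
            -- A solution `X` containing the element `k` would witness the query that was answered
            -- negatively.
            have : ask (a, s, G k ++ [true]) = true := by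
              rw [ask_iff]
              refine ⟨X, hX, hs, fun i' hi' => ?_⟩
              rw [hmem] at hi'
              split_ifs at hi' with h'
              · rwa [Fin.ext (h'.trans hi.symm)]
              · exact hsub hi'
            rw [hb] at this
            exact Bool.false_ne_true this
      · refine ⟨hb, fun X hX hs hsub i hi hiX => ?_⟩
        rw [hmem]
        split_ifs with hik
        · rfl
        · refine ih.2 X hX hs (fun i' hi' => hsub ((hmem _ _).2 ?_)) i (by omega) hiX
          split_ifs with h'
          · rfl
          · exact hi'
  have hg : a.greedy s = G a.n := rfl
  rw [hg]
  obtain ⟨X, hX, hs, hsub⟩ := (ask_iff a s (G a.n)).1 (hinv a.n).1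
  have e : a.toSet (G a.n) = X :=
    Finset.Subset.antisymm hsub fun i hi => (hinv a.n).2 X hX hs hsub i i.2 hi
  rw [e]
  exact ⟨hlen _, hX, hs⟩

/-! ### The approximation guarantee -/

/-- Two sets with the same rounded costs under one scenario have nearly the same cost. -/
theorem cost_le_of_rounded_eq (a : SchemeInput P K) {X Y : Finset (Fin a.n)} {c : Fin a.n → ℕ}
    (h : ∑ i ∈ X, a.rounded (Y.sup c) (c i) = ∑ i ∈ Y, a.rounded (Y.sup c) (c i)) :
    a.m * ∑ i ∈ X, c i ≤ (a.m + 1) * ∑ i ∈ Y, c i := by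
  have hcard : ∀ Z : Finset (Fin a.n), Z.card ≤ a.n := fun Z =>
    (Finset.card_le_univ Z).trans (by simp)
  obtain ⟨b, hb⟩ : ∃ b, b = Y.sup c := ⟨_, rfl⟩
  rw [← hb] at h
  have hY : ∀ i ∈ Y, c i ≤ b := fun i hi => hb ▸ Finset.le_sup hi
  have hYr : ∀ i ∈ Y, a.rounded b (c i) ≤ a.r := by
    intro i hi
    rw [rounded, if_pos (hY i hi)]
    exact Nat.div_le_of_le_mul (Nat.mul_le_mul_right _ (hY i hi))
  have ht : ∑ i ∈ Y, a.rounded b (c i) ≤ a.n * a.r :=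
    (Finset.sum_le_card_nsmul _ _ _ hYr).trans (Nat.mul_le_mul_right _ (hcard Y))
  -- One element above the bound already contributes `a.n * a.r + 1`, more than the whole rounded
  -- cost of `Y`.
  have hX : ∀ i ∈ X, c i ≤ b := by
    intro i hi
    by_contra hlt
    have h1 : a.rounded b (c i) = a.n * a.r + 1 := if_neg hlt
    have h2 := Finset.single_le_sum (f := fun i => a.rounded b (c i))
      (fun i _ => Nat.zero_le _) hi
    simp only [h1, h] at h2
    omega
  -- For `b = 0` rounding gives no information, but then `X` costs nothing.
  rcases Nat.eq_zero_or_pos b with hb0 | hb0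
  · rw [Finset.sum_eq_zero fun i hi => Nat.le_zero.1 (hb0 ▸ hX i hi)]
    simp
  have hn : 0 < a.n := by
    rcases Finset.eq_empty_or_nonempty Y with rfl | ⟨i, _⟩
    · simp at hb; omega
    · exact i.pos
  have hbY : b ≤ ∑ i ∈ Y, c i := by
    rw [hb]
    exact Finset.sup_le fun i hi => Finset.single_le_sum (fun i _ => Nat.zero_le _) hi
  -- Rounding down loses less than one unit, worth `b / a.r`, on each of at most `a.n` elements.
  have h1 : (∑ i ∈ X, c i) * a.r ≤ b * (∑ i ∈ X, a.rounded b (c i) + a.n) := by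
    have : ∑ i ∈ X, c i * a.r ≤ ∑ i ∈ X, b * (a.rounded b (c i) + 1) := by
      refine Finset.sum_le_sum fun i hi => ?_
      rw [rounded, if_pos (hX i hi)]
      exact (Nat.lt_mul_div_succ _ hb0).le
    rw [← Finset.sum_mul, ← Finset.mul_sum, Finset.sum_add_distrib, Finset.sum_const,
      smul_eq_mul, mul_one] at this
    exact this.trans (Nat.mul_le_mul_left _ (Nat.add_le_add_left (hcard X) _))
  have h2 : b * ∑ i ∈ Y, a.rounded b (c i) ≤ (∑ i ∈ Y, c i) * a.r := by
    rw [Finset.mul_sum, Finset.sum_mul]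
    refine Finset.sum_le_sum fun i hi => ?_
    rw [rounded, if_pos (hY i hi)]
    exact Nat.mul_div_le _ _
  rw [h, mul_add] at h1
  have h3 : (∑ i ∈ X, c i) * a.r ≤ (∑ i ∈ Y, c i) * a.r + (∑ i ∈ Y, c i) * a.n :=
    h1.trans (Nat.add_le_add h2 (Nat.mul_le_mul_right _ hbY))
  rw [r] at h3
  refine le_of_mul_le_mul_left ?_ hn
  calc a.n * (a.m * ∑ i ∈ X, c i) = (∑ i ∈ X, c i) * (a.n * a.m) := by ring
    _ ≤ _ := h3
    _ = _ := by ring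

/-- The factor `(m + 1) / m ≤ 1 + ε` holds in every scenario and passes through WOWA by monotonicity
and homogeneity. -/
theorem value_le_of_cost_le (a : SchemeInput P K) {X Y : Finset (Fin a.n)}
    (h : ∀ j : Fin K, a.m * ∑ i ∈ X, a.C j i ≤ (a.m + 1) * ∑ i ∈ Y, a.C j i) :
    (minWowa P K).value a.J X ≤ (1 + a.ε) * (minWowa P K).value a.J Y := by
  have hD : (0 : ℚ) < a.costDen := Nat.cast_pos.2 a.costDen_pos
  have hε : 0 < 1 + a.ε := by linarith [a.ε_pos]
  have hcost : ∀ (j : Fin K) (Z : Finset (Fin a.n)),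
      ((∑ i ∈ Z, a.C j i : ℕ) : ℚ) = a.costDen * solutionCost Z (a.J.cost j) := by
    intro j Z
    rw [Nat.cast_sum]
    exact (Finset.sum_congr rfl fun i _ => a.cast_C j i).trans (Finset.mul_sum _ _ _).symm
  have hnn : ∀ (j : Fin K) (Z : Finset (Fin a.n)), 0 ≤ solutionCost Z (a.J.cost j) :=
    fun j Z => Finset.sum_nonneg fun i _ => a.J.cost_nonneg j i
  have hle : ∀ j, solutionCost X (a.J.cost j) ≤ (1 + a.ε) * solutionCost Y (a.J.cost j) := by
    intro j
    have h1 : (a.m : ℚ) * ((∑ i ∈ X, a.C j i : ℕ) : ℚ) ≤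
        (a.m + 1) * ((∑ i ∈ Y, a.C j i : ℕ) : ℚ) := by exact_mod_cast h j
    rw [hcost, hcost, mul_left_comm, mul_left_comm (a.m + 1 : ℚ), mul_le_mul_iff_right₀ hD] at h1
    have hm : (0 : ℚ) < a.m := Nat.cast_pos.2 (Nat.succ_pos _)
    have h2 : 1 ≤ a.ε * a.m := by
      have := a.one_div_eps_le
      rwa [div_le_iff₀ a.ε_pos, mul_comm] at this
    refine le_of_mul_le_mul_left (h1.trans ?_) hm
    have := mul_le_mul_of_nonneg_right h2 (hnn j Y)
    linarith
  refine (wowa_mono a.J.v_nonneg a.J.p_nonneg (fun j => hnn j X) hle).trans ?_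
  exact (wowa_smul _ _ _ hε).le

/-- The guess that is right for `Y` is among those tried. Its greedy solution may differ from `Y`
but has the same rounded costs. -/
theorem exists_candidate [NeZero K] (a : SchemeInput P K) {Y : Finset (Fin a.n)}
    (hY : Y ∈ P.feasible a.J.inst) : ∃ S ∈ a.candidates,
      (minWowa P K).value a.J (a.toSet S) ≤ (1 + a.ε) * (minWowa P K).value a.J Y := by
  let b : ℕ → ℕ := fun j => Y.sup fun i => a.C j i
  let t : ℕ → ℕ := fun j => ∑ i ∈ Y, a.rounded (b j) (a.C j i)
  have ht : ∀ j, t j ≤ a.n * a.r := by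
    intro j
    refine (Finset.sum_le_card_nsmul _ _ a.r fun i hi => ?_).trans (Nat.mul_le_mul_right _
      ((Finset.card_le_univ Y).trans (by simp)))
    have hle : a.C j i ≤ b j := Finset.le_sup (f := fun i : Fin a.n => a.C j i) hi
    rw [rounded, if_pos hle]
    exact Nat.div_le_of_le_mul (Nat.mul_le_mul_right _ hle)
  let s : List (ℕ × ℕ) := (List.range K).map fun j => (b j, t j)
  have hs : ∀ j : Fin K, s.getD j (0, 0) = (b j, t j) := by
    intro j
    simp [s, List.getD_eq_getElem?_getD]
  have hmem : s ∈ a.choices := by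
    refine mem_choose K _ _ fun j _ => ?_
    refine List.mem_flatMap.2 ⟨b j, ?_, List.mem_map.2 ⟨t j, List.mem_range.2
      (Nat.lt_succ_of_le (ht j)), rfl⟩⟩
    -- The extra bound `0` in `options` serves the empty solution; otherwise the maximum is
    -- attained.
    rcases Finset.eq_empty_or_nonempty Y with h | h
    · simp [b, h]
    · obtain ⟨i, _, hi⟩ := Finset.exists_mem_eq_sup Y h fun i => a.C j i
      exact List.mem_cons_of_mem _ (List.mem_map.2 ⟨i, List.mem_range.2 i.2, hi.symm⟩)
  have hYs : a.HasRounded s Y := by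
    intro j
    rw [hs, min_eq_left (ht j)]
  have hask : ask (a, s, []) = true :=
    (ask_iff a s []).2 ⟨Y, hY, hYs, fun i hi => by simp [mem_toSet] at hi⟩
  obtain ⟨-, -, hX⟩ := a.greedy_spec hask
  refine ⟨a.greedy s, List.mem_map.2 ⟨s, List.mem_filter.2 ⟨hmem, hask⟩, rfl⟩,
    a.value_le_of_cost_le fun j => a.cost_le_of_rounded_eq ?_⟩
  have := (hX j).trans (hYs j).symm
  rwa [hs] at this

theorem candidates_spec [NeZero K] (a : SchemeInput P K) {S : List Bool} (h : S ∈ a.candidates) :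
    S.length = a.n ∧ a.toSet S ∈ P.feasible a.J.inst := by
  obtain ⟨s, hs, rfl⟩ := List.mem_map.1 h
  obtain ⟨h1, h2, -⟩ := a.greedy_spec (List.mem_filter.1 hs).2
  exact ⟨h1, h2⟩

theorem best_mem {a : SchemeInput P K} {S : List Bool} (h : a.best = some S) :
    S ∈ a.candidates ∧ ∀ T ∈ a.candidates, a.val S ≤ a.val T := by
  unfold best at h
  split_ifs at h with h0
  rw [Option.some.injEq] at h
  subst h
  rcases hc : a.candidates with _ | ⟨T, l⟩
  · simp [hc] at h0
  · simp only [List.headD_cons]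
    refine ⟨?_, fun T' hT' => argminD_le _ _ _ _ (List.mem_cons_of_mem _ hT')⟩
    rcases List.mem_cons.1 (argminD_mem (fun S => a.val S) (T :: l) T) with h | h
    · rw [h]; exact List.mem_cons_self
    · exact h

/-- The comparison is made with each feasible `Y` separately, so no optimal solution has to be
singled out. -/
theorem best_isApproximateAnswer [NeZero K] (a : SchemeInput P K) :
    (minWowa P K).IsApproximateAnswer a.J a.ε (a.best.map a.toSet) := by
  rcases h : a.best with _ | S
  · refine Set.eq_empty_iff_forall_notMem.2 fun Y hY => ?_
    obtain ⟨T, hT, -⟩ := a.exists_candidate hY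
    unfold best at h
    split_ifs at h with h0
    rw [List.isEmpty_iff.1 h0] at hT
    simp at hT
  · obtain ⟨hS, hmin⟩ := best_mem h
    refine ⟨(a.candidates_spec hS).2, fun Y hY => ?_⟩
    obtain ⟨T, hT, hle⟩ := a.exists_candidate hY
    exact (a.value_le_of_val_le (hmin T hT)).trans hle

/-- Candidates have length exactly `a.n`, so such a bit list is literally the encoded characteristic
vector of its set. -/
theorem enc_best [NeZero K] (a : SchemeInput P K) : enc a.best =
    Data.ofOption ((minWowa P K).encodeSol a.J) (a.best.map a.toSet) := by
  rcases h : a.best with _ | S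
  · rfl
  · have hlen := (a.candidates_spec (best_mem h).1).1
    have hS : S = List.ofFn fun i : Fin a.n => S.getD i false := by
      apply List.ext_getElem
      · simp [hlen]
      · intro i h1 h2
        simp [h1]
    have : Data.ofSubset (a.toSet S) = enc S := by
      conv_rhs => rw [hS]
      refine ofVec_eq_enc _ _ _ fun i => ?_
      show Data.ofBool _ = Data.ofBool _
      congr 1
      simp [mem_toSet]
    exact congrArg (Data.pair (.nat 1)) this.symm

end SchemeInput
end MinWowa

theorem mainTheorem4 (P : MinWowa.DiscreteProblem) (K : ℕ) (hK : 1 ≤ K)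
    (hexact : (MinWowa.exactProblem P K).SolvableInPseudopolynomialTime) :
    (MinWowa.minWowa P K).AdmitsFPTAS := by
  have : NeZero K := ⟨Nat.one_le_iff_ne_zero.1 hK⟩
  -- The measure on scheme inputs makes `q` the polynomial required of the approximation scheme.
  obtain ⟨-, c, T, ⟨q, hq⟩, h⟩ := MinWowa.SchemeInput.polyTime_best (K := K) hexact
  refine ⟨c, q, fun J ε hε => ?_⟩
  let a : MinWowa.SchemeInput P K := ⟨J, ε, hε⟩
  obtain ⟨t, ht, hr⟩ := h a
  refine ⟨a.best.map a.toSet, a.best_isApproximateAnswer, t, ht.trans (hq a), ?_⟩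
  rw [MinWowa.SchemeInput.enc_best] at hr
  exact hr
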